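/- **Setting.** Let $\mathbb F$ be a finite field with $|\mathbb F|=q$, let $\Omega$ be a nonempty finite set, $\mathbf P=(\Omega,\preccurlyeq)$ a poset, $(k_i)_{i\in\Omega}$ positive integers, and $\mathbf H=\prod_{i\in\Omega}\mathbb F^{k_i}$. For $\beta\in\mathbf H$ let $\operatorname{supp}(\beta)=\{i\in\Omega:\beta_i\ne 0\}$, and let the $\mathbf P$-weight $\operatorname{wt}_{\mathbf P}(\beta)$ be the number of $a\in\Omega$ with $a\preccurlyeq b$ for some $b\in\operatorname{supp}(\beta)$. For $y\in\Omega$ let $\operatorname{len}(y)$ be the largest cardinality of a chain with greatest element $y$, let $m$ be the largest cardinality of a chain in $\mathbf P$, and put $W_r=\{u\in\Omega:\operatorname{len}(u)=r\}$ for $1\le r\le m$. $\mathbf P$ is *hierarchical* if $u\preccurlyeq v$ whenever $\operatorname{len}(u)<\operatorname{len}(v)$. $\overline{\mathbf P}$ denotes the dual (opposite) poset. Let $\langle\alpha,\beta\rangle=\sum_{i\in\Omega}\sum_{t=1}^{k_i}\alpha_{i,t}\beta_{i,t}$, and for a linear code (subspace) $C\subseteq\mathbf H$ let $C^\perp=\{\beta\in\mathbf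 H:\langle\alpha,\beta\rangle=0\text{ for all }\alpha\in C\}$. Let $\mathcal Q(\mathbf H,\mathbf P)$ and $\mathcal Q(\mathbf H,\overline{\mathbf P})$ be the partitions of $\mathbf H$ into sets of vectors of equal $\mathbf P$-weight, respectively equal $\overline{\mathbf P}$-weight. Two codes have the same $\Gamma$-distribution, for a partition $\Gamma$, if they meet each member of $\Gamma$ in the same number of elements. Fix a nontrivial additive character $\chi:\mathbb F\to\mathbb C^\times$; for a partition $\Gamma$ of $\mathbf H$ let $l(\Gamma)$ be the partition in which $\alpha,\gamma$ lie in the same member if and only if $\sum_{\beta\in B}\chi(\langle\alpha,\beta\rangle)=\sum_{\beta\in B}\chi(\langle\gamma,\beta\rangle)$ for all $B\in\Gamma$. **Corollary 6.2.** Consider the following statements. 1. $\mathbf H$ satisfies the MacWilliams extension property (MEP) for $\mathbf P$-weight: for every linear code $C\subseteq\mathbf H$ and every $\mathbb F$-linear $f:C\to\mathbf H$ with $\operatorname{wt}_{\mathbf P}(f(\alpha))=\operatorname{wt}_{\mathbf P}(\alpha)$ for all $\alpha\in C$, there is a $\mathbf P$-weight preserving $\varphi\in\operatorname{Aut}_{\mathbb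 F}(\mathbf H)$ with $\varphi|_C=f$. 2. For all $\gamma,\theta\in\mathbf H$ with $\operatorname{wt}_{\mathbf P}(\gamma)=\operatorname{wt}_{\mathbf P}(\theta)$ there is a $\mathbf P$-weight preserving $\psi\in\operatorname{Aut}_{\mathbb F}(\mathbf H)$ with $\psi(\gamma)=\theta$. 3. Condition (E): $\mathbf P$ is hierarchical, and $\mathbb F^{k_u}\cong\mathbb F^{k_v}$ as $\mathbb F$-vector spaces for all $u,v\in\Omega$ with $\operatorname{len}(u)=\operatorname{len}(v)$. 4. $\mathcal Q(\mathbf H,\overline{\mathbf P})=l(\mathcal Q(\mathbf H,\mathbf P))$. 5. $\mathbf P$ admits the MacWilliams identity: whenever two linear codes $C_1,C_2\subseteq\mathbf H$ have the same $\mathcal Q(\mathbf H,\overline{\mathbf P})$-distribution, $C_1^\perp$ and $C_2^\perp$ have the same $\mathcal Q(\mathbf H,\mathbf P)$-distribution. 6. $\mathcal Q(\mathbf H,\mathbf P)$ is Fourier-reflexive: $l(l(\mathcal Q(\mathbf H,\mathbf P)))=\mathcal Q(\mathbf H,\mathbf P)$. 7. For every $r$ with $1\le r\le m$, either $k_i=1$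 for all $i\in W_r$, or $|W_r|\le q$. Then (1) holds if and only if both (3) and (7) hold; and (2), (3), (4), (5), (6) are equivalent to each other. -/

import Mathlib

namespace PosetWeight

variable {Ω : Type*} [Fintype Ω]

/-! ### Posets on a finite set -/

/-- The dual poset: `u ≼ v` in the dual iff `v ≼ u` in `P`. -/
@[reducible]
def dualPoset (P : PartialOrder Ω) : PartialOrder Ω where
  le a b := P.le b a
  lt a b := P.lt b a
  lt_iff_le_not_ge a b := P.lt_iff_le_not_ge b a
  le_refl a := P.le_refl a
  le_trans a b c hab hbc := P.le_trans c b a hbc hab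
  le_antisymm a b hab hba := P.le_antisymm a b hba hab

/-- The ideal of `P` generated by a set `B`. -/
def idealGen (P : PartialOrder Ω) (B : Set Ω) : Set Ω :=
  {a | ∃ b ∈ B, P.le a b}

/-- `len P y` is the largest cardinality of a chain in `P` with greatest element `y`. -/
noncomputable def len (P : PartialOrder Ω) (y : Ω) : ℕ :=
  sSup {n | ∃ B : Set Ω, IsChain P.le B ∧ y ∈ B ∧ (∀ b ∈ B, P.le b y) ∧ B.ncard = n}

/-- The largest cardinality of a chain in `P`. -/
noncomputable def maxChain (P : PartialOrder Ω) : ℕ :=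
  sSup {n | ∃ B : Set Ω, IsChain P.le B ∧ B.ncard = n}

/-- The `r`-th level `W_r` of `P`. -/
def level (P : PartialOrder Ω) (r : ℕ) : Set Ω :=
  {u | len P u = r}

/-- `P` is hierarchical if every element of a lower level is below every element of a
higher level. -/
def IsHierarchical (P : PartialOrder Ω) : Prop :=
  ∀ u v : Ω, len P u + 1 ≤ len P v → P.le u v

/-! ### The ambient space and the weight -/

/-- The ambient space `∏ i, F ^ (k i)`. -/
abbrev Space (F : Type*) (k : Ω → ℕ) : Type _ :=
  (i : Ω) → (Fin (k i) → F)

variable {F : Type*} [Field F] {k : Ω → ℕ}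

/-- The support of a codeword. -/
def supp (β : Space F k) : Set Ω :=
  {i | β i ≠ 0}

/-- The `P`-weight of a codeword. -/
noncomputable def wt (P : PartialOrder Ω) (β : Space F k) : ℕ :=
  (idealGen P (supp β)).ncard

/-- The MacWilliams extension property for `P`-weight. -/
def MEP (F : Type*) [Field F] (k : Ω → ℕ) (P : PartialOrder Ω) : Prop :=
  ∀ (C : Submodule F (Space F k)) (f : C →ₗ[F] Space F k),
    (∀ α : C, wt P (f α) = wt P (α : Space F k)) →
    ∃ φ : Space F k ≃ₗ[F] Space F k,
      (∀ α, wt P (φ α) = wt P α) ∧ ∀ α : C, φ α = f α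

/-- The weight-preserving linear automorphisms act transitively on the codewords of any given
`P`-weight. -/
def TransitiveOnEqualWeight (F : Type*) [Field F] (k : Ω → ℕ) (P : PartialOrder Ω) : Prop :=
  ∀ γ θ : Space F k, wt P γ = wt P θ →
    ∃ ψ : Space F k ≃ₗ[F] Space F k, (∀ α, wt P (ψ α) = wt P α) ∧ ψ γ = θ

/-- Condition (E): `P` is hierarchical, and alphabets at the same level are isomorphic. -/
def ConditionE (F : Type*) [Field F] (k : Ω → ℕ) (P : PartialOrder Ω) : Prop :=
  IsHierarchical P ∧
    ∀ u v : Ω, len P u = len P v → Nonempty ((Fin (k u) → F) ≃ₗ[F] (Fin (k v) → F))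

/-- On every level either all alphabets are one-dimensional or there are at most `|F|`
coordinates. -/
def LevelCondition (F : Type*) [Fintype F] (k : Ω → ℕ) (P : PartialOrder Ω) : Prop :=
  ∀ r : ℕ, 1 ≤ r → r ≤ maxChain P →
    (∀ i ∈ level P r, k i = 1) ∨ (level P r).ncard ≤ Fintype.card F

/-! ### Duality and partitions

A partition of the ambient space is given by the corresponding equivalence relation; its members
are the elements of `Setoid.classes`. -/

/-- The standard bilinear form on the ambient space. -/
def innerProd (α β : Space F k) : F :=
  ∑ i, ∑ t, α i t * β i t

/-- The dual code. -/
def dualCode (C : Submodule F (Space F k)) : Submodule F (Space F k) where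
  carrier := {β | ∀ α ∈ C, innerProd α β = 0}
  zero_mem' := fun α _ => by simp [innerProd]
  add_mem' := fun {a b} ha hb α hα => by
    have h : innerProd α (a + b) = innerProd α a + innerProd α b := by
      simp [innerProd, mul_add, Finset.sum_add_distrib]
    rw [h, ha α hα, hb α hα, add_zero]
  smul_mem' := fun c a ha α hα => by
    have h : innerProd α (c • a) = c * innerProd α a := by
      simp [innerProd, Finset.mul_sum, mul_left_comm]
    rw [h, ha α hα, mul_zero]

/-- The partition of the ambient space by `P`-weight. -/
noncomputable def weightPartition (F : Type*) [Field F] (k : Ω → ℕ) (P : PartialOrder Ω) :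
    Setoid (Space F k) :=
  Setoid.ker (wt P)

/-- `C₁` and `C₂` meet each member of the partition `Γ` in the same number of elements. -/
def SameDistribution (Γ : Setoid (Space F k)) (C₁ C₂ : Submodule F (Space F k)) : Prop :=
  ∀ B ∈ Γ.classes, ((C₁ : Set (Space F k)) ∩ B).ncard = ((C₂ : Set (Space F k)) ∩ B).ncard

/-- `P` admits the MacWilliams identity. -/
def MacWilliamsIdentity (F : Type*) [Field F] (k : Ω → ℕ) (P : PartialOrder Ω) : Prop :=
  ∀ C₁ C₂ : Submodule F (Space F k),
    SameDistribution (weightPartition F k (dualPoset P)) C₁ C₂ →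
    SameDistribution (weightPartition F k P) (dualCode C₁) (dualCode C₂)

/-- The dual partition of `Γ` with respect to the additive character `χ`. (The sums are finite
when `F` is finite.) -/
def dualPartition (χ : AddChar F ℂ) (Γ : Setoid (Space F k)) : Setoid (Space F k) where
  r α γ := ∀ B ∈ Γ.classes, ∑ᶠ β ∈ B, χ (innerProd α β) = ∑ᶠ β ∈ B, χ (innerProd γ β)
  iseqv :=
    { refl := fun _ _ _ => rfl
      symm := fun h B hB => (h B hB).symm
      trans := fun h h' B hB => (h B hB).trans (h' B hB) }

/-- Fourier-reflexivity of a partition. -/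
def FourierReflexive (χ : AddChar F ℂ) (Γ : Setoid (Space F k)) : Prop :=
  dualPartition χ (dualPartition χ Γ) = Γ

end PosetWeight

set_option linter.unusedSectionVars false

namespace PosetWeight

variable {Ω : Type*} [Fintype Ω]

/-! ### Chains and levels -/

/-! Everything passes through one property, `HasIntersectionNumbers`: the number of ways to write a
vector as a sum of two vectors with weights in prescribed sets depends only on its weight.
Transitivity on equal weights gives it by transport of structure; Fourier-reflexivity gives it
because the transform of a product of transforms is a convolution. It forces Condition (E). If the
poset were not hierarchical, a suitable sum of two vectors of smaller weight would have the same
weight as a vector concentrated at one point `v`, which admits no such splitting. The equality of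
dimensions within a level then follows by counting.

In a hierarchical poset a weight records exactly the highest occupied level and the number of
nonzero blocks on it. A map preserving weights on a code therefore preserves, for codewords
vanishing above a level, the number of zero blocks on that level. Attach to each block the subspace
of such codewords vanishing there. A covering count (`eq_of_countP_mem_eq`) shows that the multiset
of these subspaces is determined by how many of them contain each vector, provided blocks are
one-dimensional, the code has dimension at most one, or the level has at most `q` blocks. Equality
of the multisets yields a permutation of blocks with block isomorphisms, and a block triangular
extension. Codes of dimension at most one need no bound on the levels, whence (E) implies
transitivity. Conversely, a plane is covered by its `q + 1` lines through the origin, and this gives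
an inextensible map when a level has more than `q` blocks of dimension at least two.

For duality, (E) provides weight-preserving maps with `⟨α, ψ β⟩ = ⟨γ, β⟩` whenever `α` and `γ` have
equal dual weight, so transforms of weight functions depend only on the dual weight. Both posets
realise all weights from `0` to `|Ω|`, so the transform is a bijection between the two spaces of
weight functions; this gives the equality of partitions and reflexivity. Poisson summation links
this with the MacWilliams identity, where codes spanned by one vector already suffice. -/

theorem bddAbove_chains (P : PartialOrder Ω) (y : Ω) :
    BddAbove {n | ∃ B : Set Ω, IsChain P.le B ∧ y ∈ B ∧ (∀ b ∈ B, P.le b y) ∧ B.ncard = n} := by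
  refine ⟨Nat.card Ω, ?_⟩
  rintro n ⟨B, -, -, -, rfl⟩
  exact Set.ncard_le_card B

theorem ncard_le_len {P : PartialOrder Ω} {y : Ω} {B : Set Ω} (hB : IsChain P.le B) (hy : y ∈ B)
    (h : ∀ b ∈ B, P.le b y) : B.ncard ≤ len P y :=
  le_csSup (bddAbove_chains P y) ⟨B, hB, hy, h, rfl⟩

theorem exists_chain_ncard_eq_len (P : PartialOrder Ω) (y : Ω) :
    ∃ B : Set Ω, IsChain P.le B ∧ y ∈ B ∧ (∀ b ∈ B, P.le b y) ∧ B.ncard = len P y := by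
  refine Nat.sSup_mem ?_ (bddAbove_chains P y)
  exact ⟨_, {y}, by simp, rfl, by simp, rfl⟩

theorem one_le_len (P : PartialOrder Ω) (y : Ω) : 1 ≤ len P y := by
  have := ncard_le_len (P := P) (y := y) (B := {y}) (by simp) rfl (by simp)
  simpa using this

theorem len_le_maxChain (P : PartialOrder Ω) (y : Ω) : len P y ≤ maxChain P := by
  obtain ⟨B, hB, -, -, h⟩ := exists_chain_ncard_eq_len P y
  refine le_csSup ⟨Nat.card Ω, ?_⟩ ⟨B, hB, h⟩
  rintro n ⟨B, -, rfl⟩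
  exact Set.ncard_le_card B

theorem len_lt_len {P : PartialOrder Ω} {u v : Ω} (huv : P.le u v) (hne : u ≠ v) :
    len P u < len P v := by
  obtain ⟨B, hB, -, hle, h⟩ := exists_chain_ncard_eq_len P u
  have hv : v ∉ B := fun hv => hne (P.le_antisymm _ _ huv (hle v hv))
  have h1 : (insert v B).ncard ≤ len P v := by
    refine ncard_le_len (hB.insert fun b hb _ => Or.inr (P.le_trans _ _ _ (hle b hb) huv))
      (Set.mem_insert _ _) ?_
    rintro b (rfl | hb)
    · exact P.le_refl _
    · exact P.le_trans _ _ _ (hle b hb) huv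
  rw [Set.ncard_insert_of_notMem hv] at h1
  omega

theorem len_le_len {P : PartialOrder Ω} {u v : Ω} (huv : P.le u v) : len P u ≤ len P v := by
  by_cases h : u = v
  · rw [h]
  · exact (len_lt_len huv h).le

/-- Removing `y` from a longest chain ending at `y` leaves a chain whose top element bounds its
size. That top is found as an element of maximal `len`, since `len` increases strictly along a
chain. -/
theorem len_le_succ {P : PartialOrder Ω} {y : Ω} {r : ℕ}
    (h : ∀ x, P.le x y → x ≠ y → len P x ≤ r) : len P y ≤ r + 1 := by
  obtain ⟨B, hB, hy, hle, hn⟩ := exists_chain_ncard_eq_len P y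
  have hc : (B \ {y}).ncard + 1 = B.ncard := Set.ncard_sdiff_singleton_add_one hy
  rcases (B \ {y}).eq_empty_or_nonempty with he | hne
  · rw [he] at hc; simp at hc; omega
  · obtain ⟨z, hz, hmax⟩ := (Set.toFinite (B \ {y})).exists_maximalFor (len P) _ hne
    have hz1 : (B \ {y}).ncard ≤ len P z := by
      refine ncard_le_len (hB.mono Set.sdiff_subset) hz fun b hb => ?_
      by_cases hbz : b = z
      · exact hbz ▸ P.le_refl _
      · rcases hB hb.1 hz.1 hbz with h1 | h1
        · exact h1
        · have h2 := hmax hb (len_le_len h1)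
          have h3 := len_lt_len h1 (Ne.symm hbz)
          omega
    have := h z (hle z hz.1) hz.2
    omega

theorem IsHierarchical.le_iff {P : PartialOrder Ω} (hP : IsHierarchical P) {u v : Ω} :
    P.le u v ↔ u = v ∨ len P u < len P v := by
  constructor
  · intro h
    by_cases hne : u = v
    · exact Or.inl hne
    · exact Or.inr (len_lt_len h hne)
  · rintro (rfl | h)
    · exact P.le_refl _
    · exact hP _ _ h

/-! ### Ideals -/

theorem subset_idealGen (P : PartialOrder Ω) (B : Set Ω) : B ⊆ idealGen P B :=
  fun b hb => ⟨b, hb, P.le_refl b⟩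

theorem idealGen_mono (P : PartialOrder Ω) {A B : Set Ω} (h : A ⊆ B) :
    idealGen P A ⊆ idealGen P B :=
  fun _ ⟨b, hb, hab⟩ => ⟨b, h hb, hab⟩

theorem idealGen_eq_self {P : PartialOrder Ω} {B : Set Ω}
    (h : ∀ a b, P.le a b → b ∈ B → a ∈ B) : idealGen P B = B :=
  Set.Subset.antisymm (fun a ⟨b, hb, hab⟩ => h a b hab hb) (subset_idealGen P B)

theorem idealGen_singleton (P : PartialOrder Ω) (v : Ω) : idealGen P {v} = {a | P.le a v} := by
  ext a; simp [idealGen]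

/-- Ideals grow one element at a time by adjoining an element of least `len` outside. Hence every
poset on `Ω` realises the same set of weights, which makes the transform between weight functions a
square system. -/
theorem exists_ideal_ncard_eq (P : PartialOrder Ω) (j : ℕ) (hj : j ≤ Fintype.card Ω) :
    ∃ I : Set Ω, idealGen P I = I ∧ I.ncard = j := by
  induction j with
  | zero => exact ⟨∅, by simp [idealGen], by simp⟩
  | succ j ih =>
    obtain ⟨I, hI, hIj⟩ := ih (by omega)
    have hne : (Iᶜ).Nonempty := by
      rw [Set.nonempty_compl]
      rintro rfl
      rw [Set.ncard_univ, Nat.card_eq_fintype_card] at hIj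
      omega
    obtain ⟨x, hx, hmin⟩ := (Set.toFinite (Iᶜ)).exists_minimalFor (len P) _ hne
    refine ⟨insert x I, idealGen_eq_self ?_, by rw [Set.ncard_insert_of_notMem hx, hIj]⟩
    rintro a b hab (rfl | hb)
    · by_contra hcon
      rw [Set.mem_insert_iff, not_or] at hcon
      have h1 := hmin (j := a) hcon.2 (len_le_len hab)
      have h2 := len_lt_len hab hcon.1
      omega
    · right; rw [← hI]; exact ⟨b, hb, hab⟩

/-! ### Weights -/

variable {F : Type*} [Field F] {k : Ω → ℕ}

/-- The vector all of whose entries are `1` on `S` and `0` off `S`. -/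
noncomputable def indVec (F : Type*) [Field F] (k : Ω → ℕ) (S : Set Ω) : Space F k :=
  fun i _ => S.indicator 1 i

theorem supp_indVec (hk : ∀ i, 0 < k i) (S : Set Ω) : supp (indVec F k S) = S := by
  ext i
  by_cases hi : i ∈ S
  · simp only [supp, Set.mem_ofPred_eq, hi, iff_true]
    intro h
    have := congrFun h ⟨0, hk i⟩
    simp [indVec, hi] at this
  · simp only [supp, Set.mem_ofPred_eq, hi, iff_false, not_not]
    funext t
    simp [indVec, hi]

theorem wt_le_card (P : PartialOrder Ω) (β : Space F k) : wt P β ≤ Fintype.card Ω := by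
  rw [← Nat.card_eq_fintype_card]
  exact Set.ncard_le_card _

theorem exists_wt_eq (hk : ∀ i, 0 < k i) (P : PartialOrder Ω) {j : ℕ}
    (hj : j ≤ Fintype.card Ω) : ∃ β : Space F k, wt P β = j := by
  obtain ⟨I, hI, hIj⟩ := exists_ideal_ncard_eq P j hj
  exact ⟨indVec F k I, by rw [wt, supp_indVec hk, hI, hIj]⟩

theorem wt_congr_supp (P : PartialOrder Ω) {β γ : Space F k} (h : supp β = supp γ) :
    wt P β = wt P γ := by
  rw [wt, wt, h]

theorem supp_smul {c : F} (hc : c ≠ 0) (β : Space F k) : supp (c • β) = supp β := by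
  ext i; simp [supp, hc]

theorem supp_neg (β : Space F k) : supp (-β) = supp β := by
  ext i; simp [supp]

theorem supp_eq_empty {β : Space F k} : supp β = ∅ ↔ β = 0 := by
  simp [supp, Set.eq_empty_iff_forall_notMem, funext_iff]

theorem wt_smul (P : PartialOrder Ω) {c : F} (hc : c ≠ 0) (β : Space F k) :
    wt P (c • β) = wt P β :=
  wt_congr_supp P (supp_smul hc β)

theorem wt_neg (P : PartialOrder Ω) (β : Space F k) : wt P (-β) = wt P β :=
  wt_congr_supp P (supp_neg β)

theorem wt_zero (P : PartialOrder Ω) : wt P (0 : Space F k) = 0 := by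
  simp [wt, idealGen, supp]

theorem wt_eq_zero {P : PartialOrder Ω} {β : Space F k} : wt P β = 0 ↔ β = 0 := by
  refine ⟨fun h => ?_, fun h => by rw [h, wt_zero]⟩
  rw [wt, Set.ncard_eq_zero] at h
  exact supp_eq_empty.1 (Set.subset_empty_iff.1 (h ▸ subset_idealGen P _))

theorem wt_le_ncard {P : PartialOrder Ω} {β : Space F k} {I : Set Ω} (hI : idealGen P I = I)
    (h : supp β ⊆ I) : wt P β ≤ I.ncard := by
  rw [← hI]
  exact Set.ncard_le_ncard (idealGen_mono P h)

/-- A weight-preserving endomorphism is an automorphism. -/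
theorem exists_equiv_of_wt_preserving [Finite F] {P : PartialOrder Ω}
    (φ : Space F k →ₗ[F] Space F k) (h : ∀ α, wt P (φ α) = wt P α) :
    ∃ ψ : Space F k ≃ₗ[F] Space F k, ∀ α, ψ α = φ α := by
  have hinj : Function.Injective φ := by
    refine (injective_iff_map_eq_zero φ).2 fun a ha => ?_
    rw [← wt_eq_zero (P := P), ← h, ha, wt_zero]
  exact ⟨LinearEquiv.ofInjectiveEndo φ hinj, fun α => rfl⟩

end PosetWeight

/-! ### Fourier analysis of partitions and the MacWilliams identity. -/

namespace PosetWeight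

variable {Ω : Type*} [Fintype Ω]
variable {F : Type*} [Field F] {k : Ω → ℕ}

/-! ### The bilinear form -/

theorem innerProd_comm (α β : Space F k) : innerProd α β = innerProd β α := by
  simp [innerProd, mul_comm]

theorem innerProd_add (α β γ : Space F k) :
    innerProd α (β + γ) = innerProd α β + innerProd α γ := by
  simp [innerProd, mul_add, Finset.sum_add_distrib]

theorem innerProd_smul (c : F) (α β : Space F k) :
    innerProd α (c • β) = c * innerProd α β := by
  simp [innerProd, Finset.mul_sum, mul_left_comm]

theorem add_innerProd (α β γ : Space F k) :
    innerProd (α + β) γ = innerProd α γ + innerProd β γ := by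
  rw [innerProd_comm, innerProd_add, innerProd_comm γ, innerProd_comm γ]

theorem smul_innerProd (c : F) (α β : Space F k) :
    innerProd (c • α) β = c * innerProd α β := by
  rw [innerProd_comm, innerProd_smul, innerProd_comm]

theorem innerProd_neg (α β : Space F k) : innerProd α (-β) = -innerProd α β := by
  rw [← neg_one_smul F, innerProd_smul, neg_one_mul]

/-- The linear functional `innerProd α`. -/
def innerLin (α : Space F k) : Space F k →ₗ[F] F where
  toFun := innerProd α
  map_add' := innerProd_add α
  map_smul' c β := innerProd_smul c α β

theorem eq_zero_of_innerLin_eq_zero {α : Space F k} (h : innerLin α = 0) : α = 0 := by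
  classical
  funext i t
  have := LinearMap.congr_fun h (Pi.single i (Pi.single t 1))
  simp only [innerLin, innerProd, LinearMap.coe_mk, AddHom.coe_mk, LinearMap.zero_apply] at this
  rw [Finset.sum_eq_single i, Finset.sum_eq_single t] at this
  · simpa using this
  · intro s _ hs; simp [hs]
  · simp
  · intro j _ hj; simp [Pi.single_eq_of_ne hj]
  · simp

theorem sum_addChar_linear {χ : AddChar F ℂ} (hχ : χ ≠ 1) {V : Type*} [AddCommGroup V]
    [Module F V] [Fintype V] (f : V →ₗ[F] F) [Decidable (f = 0)] :
    ∑ v, χ (f v) = if f = 0 then (Fintype.card V : ℂ) else 0 := by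
  classical
  have h := AddChar.sum_eq_ite (χ.compAddMonoidHom f.toAddMonoidHom)
  simp only [AddChar.compAddMonoidHom_apply, LinearMap.toAddMonoidHom_coe] at h
  rw [h]
  refine if_congr ⟨fun h0 => ?_, fun h0 => ?_⟩ rfl rfl
  · by_contra hf
    obtain ⟨v, hv⟩ : ∃ v, f v ≠ 0 := by
      by_contra! hc
      exact hf (LinearMap.ext hc)
    obtain ⟨x, hx⟩ := AddChar.ne_one_iff.1 hχ
    apply hx
    have := DFunLike.congr_fun h0 ((x / f v) • v)
    simpa [hv] using this
  · subst h0
    ext v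
    simp

/-! ### Sums of class functions -/

theorem sum_mul_eq_of_class {X : Type*} [Fintype X] (Γ : Setoid X) {g f f' : X → ℂ}
    (hg : ∀ x y, Γ x y → g x = g y)
    (h : ∀ B ∈ Γ.classes, ∑ x, B.indicator f x = ∑ x, B.indicator f' x) :
    ∑ x, g x * f x = ∑ x, g x * f' x := by
  classical
  have key : ∀ f : X → ℂ, ∑ x, g x * f x =
      ∑ q : Quotient Γ, g q.out * ∑ x, {x | Γ x q.out}.indicator f x := by
    intro f
    rw [← Finset.sum_fiberwise Finset.univ (fun x => (Quotient.mk Γ x))]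
    refine Finset.sum_congr rfl fun q _ => ?_
    rw [Finset.mul_sum, Finset.sum_filter]
    refine Finset.sum_congr rfl fun x _ => ?_
    have hx : Quotient.mk Γ x = q ↔ Γ x q.out := by
      rw [← Quotient.eq (r := Γ), Quotient.out_eq]
    by_cases hq : Γ x q.out
    · rw [if_pos (hx.2 hq), Set.indicator_of_mem (by exact hq), hg _ _ hq]
    · rw [if_neg (fun h => hq (hx.1 h)), Set.indicator_of_notMem (by exact hq), mul_zero]
  rw [key, key]
  exact Finset.sum_congr rfl fun q _ => by rw [h _ (Γ.mem_classes q.out)]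

theorem ncard_eq_sum_indicator {X : Type*} [Fintype X] (S : Set X) :
    (S.ncard : ℂ) = ∑ x, S.indicator 1 x := by
  classical
  rw [Set.ncard_eq_toFinset_card']
  simp [Set.indicator_apply]

/-! ### Character sums -/

variable [Fintype F] [DecidableEq Ω] {χ : AddChar F ℂ}

/-- The Fourier transform of `g`. -/
noncomputable def charSum (χ : AddChar F ℂ) (g : Space F k → ℂ) (α : Space F k) : ℂ :=
  ∑ β, g β * χ (innerProd α β)

theorem finsum_mem_eq_charSum (B : Set (Space F k)) (α : Space F k) :
    ∑ᶠ β ∈ B, χ (innerProd α β) = charSum χ (B.indicator 1) α := by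
  classical
  rw [finsum_mem_def, finsum_eq_sum_of_fintype, charSum]
  refine Finset.sum_congr rfl fun β _ => ?_
  by_cases hβ : β ∈ B <;> simp [hβ]

/-- Functions constant on the members of `Γ` are combinations of indicators of members, so the
defining condition extends to all of them. This form makes products and repeated transforms
available. -/
theorem dualPartition_iff {Γ : Setoid (Space F k)} {α γ : Space F k} :
    dualPartition χ Γ α γ ↔
      ∀ g : Space F k → ℂ, (∀ x y, Γ x y → g x = g y) → charSum χ g α = charSum χ g γ := by
  constructor
  · intro h g hg
    refine sum_mul_eq_of_class Γ hg fun B hB => ?_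
    have := h B hB
    rwa [finsum_mem_def, finsum_mem_def, finsum_eq_sum_of_fintype, finsum_eq_sum_of_fintype] at this
  · intro h B hB
    rw [finsum_mem_eq_charSum, finsum_mem_eq_charSum]
    refine h _ fun x y hxy => ?_
    have hiff : x ∈ B ↔ y ∈ B := by
      obtain ⟨z, rfl⟩ := hB
      exact ⟨fun hx => Γ.trans (Γ.symm hxy) hx, fun hy => Γ.trans hxy hy⟩
    by_cases hy : y ∈ B
    · simp [hy, hiff.2 hy]
    · simp [hy, mt hiff.1 hy]

theorem charSum_charSum (hχ : χ ≠ 1) (g : Space F k → ℂ) (γ : Space F k) :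
    charSum χ (charSum χ g) γ = Fintype.card (Space F k) * g (-γ) := by
  classical
  simp only [charSum, Finset.sum_mul]
  rw [Finset.sum_comm]
  have h : ∀ β : Space F k,
      ∑ α : Space F k, g β * χ (innerProd α β) * χ (innerProd γ α) =
        if β = -γ then Fintype.card (Space F k) * g (-γ) else 0 := by
    intro β
    have h1 : ∀ α : Space F k, g β * χ (innerProd α β) * χ (innerProd γ α) =
        g β * χ (innerLin (β + γ) α) := fun α => by
      rw [mul_assoc, ← AddChar.map_add_eq_mul, innerProd_comm α]
      exact congrArg (fun z => g β * χ z) (add_innerProd _ _ _).symm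
    simp only [h1]
    rw [← Finset.mul_sum, sum_addChar_linear hχ]
    by_cases hβ : β = -γ
    · subst hβ
      have h0 : innerLin (-γ + γ) = 0 := by
        refine LinearMap.ext fun x => ?_
        rw [neg_add_cancel]; simp [innerLin, innerProd]
      rw [if_pos h0, if_pos rfl, mul_comm]
    · rw [if_neg hβ, if_neg, mul_zero]
      exact fun h0 => hβ (eq_neg_of_add_eq_zero_left (eq_zero_of_innerLin_eq_zero h0))
  simp [h]

theorem charSum_injective (hχ : χ ≠ 1) {g : Space F k → ℂ} (h : ∀ α, charSum χ g α = 0) :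
    g = 0 := by
  funext γ
  have h1 := charSum_charSum hχ g (-γ)
  have h2 : charSum χ g = 0 := funext h
  rw [h2, neg_neg] at h1
  have h3 : charSum χ (0 : Space F k → ℂ) (-γ) = 0 := by simp [charSum]
  rw [h3] at h1
  have h4 : (Fintype.card (Space F k) : ℂ) ≠ 0 := Nat.cast_ne_zero.2 Fintype.card_ne_zero
  exact (mul_eq_zero.1 h1.symm).resolve_left h4

theorem charSum_conv (a b : Space F k → ℂ) (α : Space F k) :
    charSum χ (fun γ => ∑ β, a β * b (γ - β)) α = charSum χ a α * charSum χ b α := by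
  rw [charSum, charSum, charSum, Finset.sum_mul_sum]
  simp only [Finset.sum_mul]
  rw [Finset.sum_comm]
  refine Finset.sum_congr rfl fun β _ => ?_
  refine Fintype.sum_equiv (Equiv.subRight β) _ _ fun γ => ?_
  have : innerProd α γ = innerProd α β + innerProd α (γ - β) := by
    rw [← innerProd_add, add_sub_cancel]
  simp only [Equiv.subRight_apply]
  rw [this, AddChar.map_add_eq_mul]
  ring

/-- The transform of the indicator of a member of `Γ` is constant on the members of the dual
partition, so the bidual relation preserves its inverse transform and separates that member from the
others. -/
theorem dualPartition_dualPartition_le (hχ : χ ≠ 1) (Γ : Setoid (Space F k)) :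
    dualPartition χ (dualPartition χ Γ) ≤ Γ := by
  classical
  intro α γ h
  set g : Space F k → ℂ := {x | Γ x α}.indicator 1 with hg
  have hgc : ∀ x y, Γ x y → g x = g y := by
    intro x y hxy
    have hiff : x ∈ {x | Γ x α} ↔ y ∈ {x | Γ x α} :=
      ⟨fun hx => Γ.trans (Γ.symm hxy) hx, fun hy => Γ.trans hxy hy⟩
    by_cases hy : y ∈ {x | Γ x α}
    · rw [hg, Set.indicator_of_mem hy, Set.indicator_of_mem (hiff.2 hy)]; rfl
    · rw [hg, Set.indicator_of_notMem hy, Set.indicator_of_notMem (mt hiff.1 hy)]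
  -- Conjugating the first transform removes the sign that a double transform puts on the argument.
  have hval : ∀ x, charSum χ (fun y => starRingEnd ℂ (charSum χ g y)) x =
      Fintype.card (Space F k) * starRingEnd ℂ (g x) := by
    intro x
    have h1 := congrArg (starRingEnd ℂ) (charSum_charSum hχ g (-x))
    rw [neg_neg, map_mul, Complex.conj_natCast] at h1
    rw [← h1, charSum, charSum, map_sum]
    refine Finset.sum_congr rfl fun y _ => ?_
    rw [map_mul, ← AddChar.map_neg_eq_conj, innerProd_comm (-x), innerProd_neg, neg_neg,
      innerProd_comm]
  have h2 := dualPartition_iff.1 h (fun y => starRingEnd ℂ (charSum χ g y)) fun x y hxy => by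
    rw [dualPartition_iff.1 hxy g hgc]
  rw [hval, hval] at h2
  have h4 : (Fintype.card (Space F k) : ℂ) ≠ 0 := Nat.cast_ne_zero.2 Fintype.card_ne_zero
  have h5 := mul_left_cancel₀ h4 h2
  have h6 : g α = 1 := Set.indicator_of_mem (s := {x | Γ x α}) (Γ.refl α) _
  rw [h6] at h5
  by_contra hcon
  have h7 : g γ = 0 :=
    Set.indicator_of_notMem (s := {x | Γ x α}) (fun h => hcon (Γ.symm h)) _
  rw [h7] at h5
  simp at h5

theorem dualPartition_mono {Γ Γ' : Setoid (Space F k)} (h : Γ ≤ Γ') :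
    dualPartition χ Γ ≤ dualPartition χ Γ' := by
  intro α γ hαγ
  rw [dualPartition_iff] at hαγ ⊢
  exact fun g hg => hαγ g fun x y hxy => hg x y (h hxy)

theorem dualPartition_eq_of_le (hχ : χ ≠ 1) {Γ Λ : Setoid (Space F k)}
    (h1 : Λ ≤ dualPartition χ Γ) (h2 : Γ ≤ dualPartition χ Λ) : dualPartition χ Γ = Λ :=
  le_antisymm ((dualPartition_mono h2).trans (dualPartition_dualPartition_le hχ Λ)) h1

/-! ### Weight partitions -/

theorem weightPartition_iff {P : PartialOrder Ω} {α γ : Space F k} :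
    weightPartition F k P α γ ↔ wt P α = wt P γ := Iff.rfl

/-- The coefficients of a decomposition of a vector into two vectors of prescribed weights depend
only on the weight of the vector. -/
def HasIntersectionNumbers (F : Type*) [Field F] (k : Ω → ℕ) (P : PartialOrder Ω) : Prop :=
  ∀ γ θ : Space F k, wt P γ = wt P θ → ∀ A B : Set ℕ,
    {β | wt P β ∈ A ∧ wt P (γ - β) ∈ B}.ncard = {β | wt P β ∈ A ∧ wt P (θ - β) ∈ B}.ncard

theorem TransitiveOnEqualWeight.hasIntersectionNumbers {P : PartialOrder Ω}
    (h : TransitiveOnEqualWeight F k P) : HasIntersectionNumbers F k P := by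
  intro γ θ hγθ A B
  obtain ⟨ψ, hψ, rfl⟩ := h γ θ hγθ
  rw [← Set.ncard_image_of_injective _ ψ.injective]
  congr 1
  ext β
  constructor
  · rintro ⟨β, ⟨h1, h2⟩, rfl⟩
    exact ⟨by rwa [hψ], by rwa [← map_sub, hψ]⟩
  · rintro ⟨h1, h2⟩
    refine ⟨ψ.symm β, ⟨?_, ?_⟩, by simp⟩
    · rwa [← hψ, ψ.apply_symm_apply]
    · rwa [← hψ, map_sub, ψ.apply_symm_apply]

/-- The transforms of two weight functions are constant on the dual partition, hence so is their
product. Transforming the product gives a convolution, whose value is the required count up to the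
factor `|H|`; reflexivity makes it a function of the weight. -/
theorem FourierReflexive.hasIntersectionNumbers (hχ : χ ≠ 1) {P : PartialOrder Ω}
    (h : FourierReflexive χ (weightPartition F k P)) : HasIntersectionNumbers F k P := by
  classical
  intro γ θ hγθ A B
  set a : Space F k → ℂ := fun β => A.indicator 1 (wt P β)
  set b : Space F k → ℂ := fun β => B.indicator 1 (wt P β)
  have hcount : ∀ γ : Space F k, ((({β | wt P β ∈ A ∧ wt P (γ - β) ∈ B} :
      Set (Space F k)).ncard : ℕ) : ℂ) = ∑ β, a β * b (γ - β) := by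
    intro γ
    rw [ncard_eq_sum_indicator]
    refine Finset.sum_congr rfl fun β _ => ?_
    by_cases h1 : wt P β ∈ A <;> by_cases h2 : wt P (γ - β) ∈ B <;> simp [a, b, h1, h2]
  have hconv : ∀ γ, charSum χ (fun α => charSum χ a α * charSum χ b α) γ =
      Fintype.card (Space F k) * ∑ β, a β * b (-γ - β) := by
    intro γ
    rw [← charSum_charSum hχ (fun γ => ∑ β, a β * b (γ - β))]
    congr 1
    funext α
    rw [charSum_conv]
  have hrel : dualPartition χ (dualPartition χ (weightPartition F k P)) (-γ) (-θ) := by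
    rw [h, weightPartition_iff, wt_neg, wt_neg, hγθ]
  have h1 := dualPartition_iff.1 hrel (fun α => charSum χ a α * charSum χ b α) fun x y hxy => by
    rw [dualPartition_iff] at hxy
    rw [hxy a fun x y h => by simp only [a, weightPartition_iff.1 h],
      hxy b fun x y h => by simp only [b, weightPartition_iff.1 h]]
  rw [hconv, hconv, neg_neg, neg_neg, ← hcount, ← hcount] at h1
  have h4 : (Fintype.card (Space F k) : ℂ) ≠ 0 := Nat.cast_ne_zero.2 Fintype.card_ne_zero
  exact_mod_cast mul_left_cancel₀ h4 h1

/-- The Fourier transforms of the functions of the `P`-weight are all functions of the weight for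
`R`, once they are functions of the latter. -/
theorem weightPartition_le_dualPartition_symm (hχ : χ ≠ 1) (hk : ∀ i, 0 < k i)
    {P R : PartialOrder Ω} (h : weightPartition F k R ≤ dualPartition χ (weightPartition F k P)) :
    weightPartition F k P ≤ dualPartition χ (weightPartition F k R) := by
  classical
  set n := Fintype.card Ω
  have hP : ∀ j : Fin (n + 1), ∃ β : Space F k, wt P β = j := fun j =>
    exists_wt_eq hk P (Nat.lt_succ_iff.1 j.2)
  have hR : ∀ j : Fin (n + 1), ∃ β : Space F k, wt R β = j := fun j =>
    exists_wt_eq hk R (Nat.lt_succ_iff.1 j.2)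
  choose p hp using hP
  choose r hr using hR
  let w (P : PartialOrder Ω) (β : Space F k) : Fin (n + 1) :=
    ⟨wt P β, Nat.lt_succ_iff.2 (wt_le_card P β)⟩
  -- The Fourier transform as an operator from functions of the `P`-weight to functions of the
  -- `R`-weight. Fourier inversion makes it injective, and equal dimensions make it surjective, so
  -- every function of the `R`-weight is a transform.
  let T : (Fin (n + 1) → ℂ) →ₗ[ℂ] (Fin (n + 1) → ℂ) :=
    { toFun := fun c a => charSum χ (fun β => c (w P β)) (r a)
      map_add' := fun c d => by
        funext a; simp [charSum, add_mul, Finset.sum_add_distrib]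
      map_smul' := fun z c => by
        funext a; simp [charSum, Finset.mul_sum, mul_assoc] }
  have hT : ∀ c α, charSum χ (fun β => c (w P β)) α = T c (w R α) := by
    intro c α
    have hα : weightPartition F k R α (r (w R α)) := by
      rw [weightPartition_iff, hr]
    exact dualPartition_iff.1 (h hα) _ fun x y hxy =>
      congrArg c (Fin.ext (weightPartition_iff.1 hxy))
  have hinj : Function.Injective T := by
    refine (injective_iff_map_eq_zero T).2 fun c hc => ?_
    have h0 := charSum_injective hχ (g := fun β => c (w P β)) fun α => by rw [hT, hc]; rfl
    funext j
    have := congrFun h0 (p j)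
    have hj : w P (p j) = j := Fin.ext (hp j)
    simpa [hj] using this
  have hsurj : Function.Surjective T := LinearMap.injective_iff_surjective.1 hinj
  intro γ θ hγθ
  rw [dualPartition_iff]
  intro g hg
  obtain ⟨c, hc⟩ := hsurj fun a => g (r a)
  have hgc : g = charSum χ (fun β => c (w P β)) := by
    funext α
    rw [hT, hc]
    exact hg _ _ (by rw [weightPartition_iff, hr])
  rw [hgc, charSum_charSum hχ, charSum_charSum hχ]
  have : w P (-γ) = w P (-θ) := Fin.ext (by
    simp only [w]; rw [wt_neg, wt_neg, weightPartition_iff.1 hγθ])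
  rw [this]

/-! ### The MacWilliams identity -/

theorem mem_classes_weightPartition {P : PartialOrder Ω} {B : Set (Space F k)}
    (hB : B ∈ (weightPartition F k P).classes) : ∃ w, B = {β | wt P β = w} := by
  obtain ⟨y, rfl⟩ := hB
  exact ⟨wt P y, rfl⟩

/-- Poisson summation: a character summed over `C` gives `|C|` if it is trivial on `C` and `0`
otherwise. -/
theorem sum_charSum_submodule (hχ : χ ≠ 1) (B : Set (Space F k))
    (C : Submodule F (Space F k)) :
    ∑ β, charSum χ (B.indicator 1) β * (C : Set (Space F k)).indicator 1 β =
      (C : Set (Space F k)).ncard * ((dualCode C : Set (Space F k)) ∩ B).ncard := by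
  classical
  have h1 : ∑ β, charSum χ (B.indicator 1) β * (C : Set (Space F k)).indicator 1 β =
      ∑ c : C, charSum χ (B.indicator 1) (c : Space F k) := by
    simp only [Set.indicator_apply, SetLike.mem_coe, Pi.one_apply, mul_ite, mul_one, mul_zero]
    rw [← Finset.sum_filter]
    exact Finset.sum_subtype _ (by simp) _
  have h2 : ∀ b : Space F k, ∑ c : C, χ (innerProd (c : Space F k) b) =
      (C : Set (Space F k)).ncard * (dualCode C : Set (Space F k)).indicator 1 b := by
    intro b
    have h3 : ∀ c : C, innerProd (c : Space F k) b = ((innerLin b).comp C.subtype) c :=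
      fun c => innerProd_comm _ _
    simp only [h3]
    rw [sum_addChar_linear hχ]
    have h4 : (innerLin b).comp C.subtype = 0 ↔ b ∈ (dualCode C : Set (Space F k)) := by
      constructor
      · intro h α hα
        have := LinearMap.congr_fun h ⟨α, hα⟩
        rwa [← h3] at this
      · intro h
        ext c
        rw [← h3]
        exact h c c.2
    by_cases hb : b ∈ (dualCode C : Set (Space F k))
    · rw [if_pos (h4.2 hb), Set.indicator_of_mem hb, Pi.one_apply, mul_one,
        ← Nat.card_coe_set_eq, Nat.card_eq_fintype_card]
      rfl
    · rw [if_neg (mt h4.1 hb), Set.indicator_of_notMem hb, mul_zero]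
  rw [h1]
  simp only [charSum]
  rw [Finset.sum_comm, ncard_eq_sum_indicator ((dualCode C : Set (Space F k)) ∩ B),
    Finset.mul_sum]
  refine Finset.sum_congr rfl fun b _ => ?_
  rw [← Finset.mul_sum, h2, Set.inter_indicator_one, Pi.mul_apply]
  ring

theorem macWilliamsIdentity_of_le (hχ : χ ≠ 1) {P : PartialOrder Ω}
    (h : weightPartition F k (dualPoset P) ≤ dualPartition χ (weightPartition F k P)) :
    MacWilliamsIdentity F k P := by
  intro C₁ C₂ hC B hB
  have key : ∀ g : Space F k → ℂ, (∀ x y, weightPartition F k (dualPoset P) x y → g x = g y) →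
      ∑ β, g β * (C₁ : Set (Space F k)).indicator 1 β =
        ∑ β, g β * (C₂ : Set (Space F k)).indicator 1 β := by
    intro g hg
    refine sum_mul_eq_of_class _ hg fun B hB => ?_
    simp only [Set.indicator_indicator]
    rw [← ncard_eq_sum_indicator, ← ncard_eq_sum_indicator, Set.inter_comm, hC B hB,
      Set.inter_comm]
  -- Equal distributions force equal sizes, so the factor `|C|` in Poisson summation cancels.
  have hcard : ((C₁ : Set (Space F k)).ncard : ℂ) = (C₂ : Set (Space F k)).ncard := by
    have := key (fun _ => 1) fun _ _ _ => rfl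
    simp only [one_mul] at this
    rw [ncard_eq_sum_indicator, ncard_eq_sum_indicator, this]
  have h1 := key (charSum χ (B.indicator 1)) fun x y hxy => by
    have := h hxy B hB
    rwa [finsum_mem_eq_charSum, finsum_mem_eq_charSum] at this
  rw [sum_charSum_submodule hχ, sum_charSum_submodule hχ, hcard] at h1
  have h4 : ((C₂ : Set (Space F k)).ncard : ℂ) ≠ 0 := by
    rw [Nat.cast_ne_zero]
    exact Set.ncard_ne_zero_of_mem C₂.zero_mem
  exact_mod_cast mul_left_cancel₀ h4 h1

theorem sameDistribution_span {P : PartialOrder Ω} {γ θ : Space F k} (h : wt P γ = wt P θ) :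
    SameDistribution (weightPartition F k P) (F ∙ γ) (F ∙ θ) := by
  intro B hB
  obtain ⟨w, rfl⟩ := mem_classes_weightPartition hB
  by_cases hγ : γ = 0
  · have hθ : θ = 0 := by rw [← wt_eq_zero (P := P), ← h, hγ, wt_zero]
    rw [hγ, hθ]
  have hθ : θ ≠ 0 := by rwa [Ne, ← wt_eq_zero (P := P), ← h, wt_eq_zero]
  have key : ∀ γ : Space F k, γ ≠ 0 → ((F ∙ γ : Submodule F (Space F k)) : Set (Space F k)) ∩
      {β | wt P β = w} = (fun t : F => t • γ) '' {t | wt P (t • γ) = w} := by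
    intro γ hγ
    ext β
    simp only [Set.mem_inter_iff, SetLike.mem_coe, Submodule.mem_span_singleton,
      Set.mem_ofPred_eq, Set.mem_image]
    constructor
    · rintro ⟨⟨t, rfl⟩, ht⟩
      exact ⟨t, ht, rfl⟩
    · rintro ⟨t, ht, rfl⟩
      exact ⟨⟨t, rfl⟩, ht⟩
  rw [key γ hγ, key θ hθ, Set.ncard_image_of_injective _ (smul_left_injective F hγ),
    Set.ncard_image_of_injective _ (smul_left_injective F hθ)]
  congr 1
  ext t
  by_cases ht : t = 0
  · simp [ht]
  · simp only [Set.mem_ofPred_eq]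
    rw [wt_smul P ht, wt_smul P ht, h]

theorem charSum_smul {P : PartialOrder Ω} {g : Space F k → ℂ}
    (hg : ∀ x y, weightPartition F k P x y → g x = g y) {t : F} (ht : t ≠ 0) (α : Space F k) :
    charSum χ g (t • α) = charSum χ g α := by
  rw [charSum, charSum]
  refine Fintype.sum_equiv (LinearEquiv.smulOfNeZero F (Space F k) t ht).toEquiv _ _ fun β => ?_
  have h1 : (LinearEquiv.smulOfNeZero F (Space F k) t ht).toEquiv β = t • β := rfl
  rw [h1, smul_innerProd, ← innerProd_smul, hg β (t • β) (wt_smul P ht β).symm]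

theorem sum_charSum_smul (hχ : χ ≠ 1) (B : Set (Space F k)) (α : Space F k) :
    ∑ t : F, charSum χ (B.indicator 1) (t • α) =
      Fintype.card F * ((dualCode (F ∙ α) : Set (Space F k)) ∩ B).ncard := by
  classical
  simp only [charSum]
  rw [Finset.sum_comm, ncard_eq_sum_indicator, Finset.mul_sum]
  refine Finset.sum_congr rfl fun b _ => ?_
  rw [← Finset.mul_sum, Set.inter_indicator_one, Pi.mul_apply]
  have h1 : ∀ t : F, innerProd (t • α) b = (LinearMap.mulRight F (innerProd α b)) t := fun t => by
    rw [smul_innerProd]; rfl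
  simp only [h1]
  rw [sum_addChar_linear hχ]
  have h2 : LinearMap.mulRight F (innerProd α b) = 0 ↔
      b ∈ (dualCode (F ∙ α) : Set (Space F k)) := by
    constructor
    · intro h β hβ
      obtain ⟨t, rfl⟩ := Submodule.mem_span_singleton.1 hβ
      rw [h1, h]; rfl
    · intro h
      have h3 : innerProd α b = 0 := h α (Submodule.mem_span_singleton_self α)
      rw [h3]
      ext; simp
  by_cases hb : b ∈ (dualCode (F ∙ α) : Set (Space F k))
  · rw [if_pos (h2.2 hb), Set.indicator_of_mem hb, Pi.one_apply]
    ring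
  · rw [if_neg (mt h2.1 hb), Set.indicator_of_notMem hb]
    ring

theorem MacWilliamsIdentity.le_dualPartition (hχ : χ ≠ 1) {P : PartialOrder Ω}
    (h : MacWilliamsIdentity F k P) :
    weightPartition F k (dualPoset P) ≤ dualPartition χ (weightPartition F k P) := by
  classical
  intro γ θ hγθ B hB
  have hg : ∀ x y, weightPartition F k P x y →
      B.indicator (1 : Space F k → ℂ) x = B.indicator 1 y := by
    obtain ⟨w, rfl⟩ := mem_classes_weightPartition hB
    intro x y hxy
    simp only [Set.indicator_apply, Set.mem_ofPred_eq, weightPartition_iff.1 hxy, Pi.one_apply]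
  -- The transform of a weight class is constant on nonzero multiples of `α`, so Poisson summation
  -- over the scalars contains one unknown value, with coefficient `q - 1 ≠ 0`.
  have h1 : ∀ α : Space F k, charSum χ (B.indicator 1) 0 +
      ((Fintype.card F : ℂ) - 1) * charSum χ (B.indicator 1) α =
      Fintype.card F * ((dualCode (F ∙ α) : Set (Space F k)) ∩ B).ncard := by
    intro α
    rw [← sum_charSum_smul hχ, ← Finset.add_sum_erase _ _ (Finset.mem_univ (0 : F)), zero_smul,
      Finset.sum_congr rfl fun t ht => charSum_smul (χ := χ) hg (Finset.ne_of_mem_erase ht) α,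
      Finset.sum_const, Finset.card_erase_of_mem (Finset.mem_univ _), nsmul_eq_mul,
      Finset.card_univ, Nat.cast_sub Fintype.card_pos, Nat.cast_one]
  have h2 := h _ _ (sameDistribution_span hγθ) B hB
  have h3 := (h1 γ).trans ((congrArg (fun n : ℕ => (Fintype.card F : ℂ) * n) h2).trans (h1 θ).symm)
  have h4 : (Fintype.card F : ℂ) - 1 ≠ 0 := by
    have := Fintype.one_lt_card (α := F)
    rw [sub_ne_zero]
    exact_mod_cast this.ne'
  rw [finsum_mem_eq_charSum, finsum_mem_eq_charSum]
  exact mul_left_cancel₀ h4 (add_left_cancel h3)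

end PosetWeight

namespace PosetWeight

variable {Ω : Type*} [Fintype Ω]
variable {F : Type*} [Field F] {k : Ω → ℕ}

/-! ### Intersection numbers force a hierarchical poset -/

variable [Fintype F]

theorem HasIntersectionNumbers.exists_sub {P : PartialOrder Ω} (h : HasIntersectionNumbers F k P)
    {γ θ : Space F k} (hγθ : wt P γ = wt P θ) (β : Space F k) :
    ∃ η, wt P η = wt P β ∧ wt P (θ - η) = wt P (γ - β) := by
  have h1 := h γ θ hγθ {wt P β} {wt P (γ - β)}
  have h2 : {η | wt P η ∈ ({wt P β} : Set ℕ) ∧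
      wt P (γ - η) ∈ ({wt P (γ - β)} : Set ℕ)}.ncard ≠ 0 :=
    Set.ncard_ne_zero_of_mem (a := β) ⟨rfl, rfl⟩
  rw [h1] at h2
  exact Set.nonempty_of_ncard_ne_zero h2

theorem le_wt_of_ne_zero {P : PartialOrder Ω} {β : Space F k} {v : Ω} (h : β v ≠ 0) :
    {x | P.le x v}.ncard ≤ wt P β := by
  rw [← idealGen_singleton]
  exact Set.ncard_le_ncard (idealGen_mono P (Set.singleton_subset_iff.2 h))

theorem wt_indVec (hk : ∀ i, 0 < k i) (P : PartialOrder Ω) (S : Set Ω) :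
    wt P (indVec F k S) = (idealGen P S).ncard := by
  rw [wt, supp_indVec hk]

/-- Consider a counterexample `u`, `v` with `v` as low as possible, and let `A` be the set of
elements strictly below `v`. The indicators of `A ∪ {u}` and of `{v}` both have weight `|A| + 1`.
The first is a sum of two vectors of smaller weight, the indicators of `{u}` and `A`; in any
splitting of the second, some summand is nonzero at `v` and has weight at least `|A| + 1`. -/
theorem HasIntersectionNumbers.le_of_len_lt (hk : ∀ i, 0 < k i) {P : PartialOrder Ω}
    (h : HasIntersectionNumbers F k P) (r : ℕ) :
    ∀ u v, len P u ≤ r → r < len P v → P.le u v := by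
  induction r with
  | zero =>
    intro u v hu
    have := one_le_len P u
    omega
  | succ r ih =>
    intro u v hu hv
    rcases Nat.lt_or_ge r (len P u) with hru | hru
    swap
    · exact ih u v hru (by omega)
    by_contra hcon
    obtain ⟨v, ⟨hv, huv⟩, hmin⟩ := (Set.toFinite {v | r + 1 < len P v ∧ ¬ P.le u v}).exists_minimalFor
      (len P) _ ⟨v, hv, hcon⟩
    have hbelow : ∀ x, P.le x v → x ≠ v → len P x ≤ r + 1 := by
      intro x hxv hne
      by_contra! hx
      have h1 := hmin (j := x) ⟨hx, fun hux => huv (P.le_trans _ _ _ hux hxv)⟩ (len_le_len hxv)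
      have h2 := len_lt_len hxv hne
      omega
    -- This `a` belongs to `A` but not to the ideal of `u`, which makes the weight of the indicator
    -- of `{u}` strictly smaller than `|A| + 1`.
    obtain ⟨a, hav, hane, ha⟩ : ∃ a, P.le a v ∧ a ≠ v ∧ r < len P a := by
      by_contra! hc
      have := len_le_succ (P := P) (y := v) (r := r) hc
      omega
    set A : Set Ω := {x | P.le x v ∧ x ≠ v} with hA
    have hvA : {x | P.le x v} = insert v A := by
      ext x
      simp only [hA, Set.mem_insert_iff, Set.mem_ofPred_eq]
      by_cases hx : x = v
      · simp [hx]
      · simp [hx]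
    have huA : u ∉ A := fun hu => huv hu.1
    have hvA' : v ∉ A := fun hv => hv.2 rfl
    have hAideal : idealGen P A = A := by
      refine idealGen_eq_self fun x y hxy hy => ⟨P.le_trans _ _ _ hxy hy.1, ?_⟩
      rintro rfl
      exact hy.2 (P.le_antisymm _ _ hy.1 hxy)
    have hbelow_u : ∀ x, P.le x u → x ≠ u → x ∈ A := by
      intro x hx hne
      have h1 := len_lt_len hx hne
      have h2 := ih x v (by omega) (by omega)
      exact ⟨h2, fun h3 => by rw [h3] at h1; omega⟩
    have hSideal : idealGen P (insert u A) = insert u A := by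
      refine idealGen_eq_self ?_
      rintro x y hxy (rfl | hy)
      · by_cases hne : x = y
        · exact Or.inl hne
        · exact Or.inr (hbelow_u x hxy hne)
      · exact Or.inr (hAideal ▸ ⟨y, hy, hxy⟩)
    have hγ : wt P (indVec F k (insert u A)) = A.ncard + 1 := by
      rw [wt_indVec hk, hSideal, Set.ncard_insert_of_notMem huA]
    have hθ : wt P (indVec F k {v}) = A.ncard + 1 := by
      rw [wt_indVec hk, idealGen_singleton, hvA, Set.ncard_insert_of_notMem hvA']
    have hβ : wt P (indVec F k {u}) < A.ncard + 1 := by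
      rw [wt_indVec hk, idealGen_singleton, ← hγ, wt_indVec hk, hSideal]
      refine Set.ncard_lt_ncard ⟨fun x hx => ?_, fun hsub => ?_⟩
      · by_cases hne : x = u
        · exact Or.inl hne
        · exact Or.inr (hbelow_u x hx hne)
      · have hau : P.le a u := hsub (Or.inr ⟨hav, hane⟩)
        have hne : a ≠ u := fun h => huA (h ▸ ⟨hav, hane⟩)
        have := len_lt_len hau hne
        omega
    have hsub : indVec F k (insert u A) - indVec F k {u} = indVec F k A := by
      funext i t
      by_cases hi : i = u
      · subst hi; simp [indVec, huA]
      · by_cases hiA : i ∈ A <;> simp [indVec, hi, hiA]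
    obtain ⟨η, h1, h2⟩ := h.exists_sub (hγ.trans hθ.symm) (indVec F k {u})
    rw [hsub, wt_indVec hk P A, hAideal] at h2
    have hv1 : {x | P.le x v}.ncard = A.ncard + 1 := by
      rw [hvA, Set.ncard_insert_of_notMem hvA']
    by_cases hηv : η v = 0
    · have h3 : (indVec F k {v} - η) v ≠ 0 := by
        rw [Pi.sub_apply, hηv, sub_zero]
        have : v ∈ supp (indVec F k {v}) := by rw [supp_indVec hk]; rfl
        exact this
      have := le_wt_of_ne_zero (P := P) h3
      omega
    · have := le_wt_of_ne_zero (P := P) hηv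
      omega

/-- One of `β` and its complement in the indicator is nonzero at `u`, and outside the ideal of `u`
the two agree up to sign. A nonzero entry there would push the weight of that one beyond the size of
the ideal. -/
theorem wt_le_and_wt_sub_le_iff (hk : ∀ i, 0 < k i) {P : PartialOrder Ω} (u : Ω) (β : Space F k) :
    wt P β ∈ Set.Iic (wt P (indVec F k {u})) ∧
        wt P (indVec F k {u} - β) ∈ Set.Iic (wt P (indVec F k {u})) ↔
      ∀ i, ¬ P.le i u → β i = 0 := by
  have hu : wt P (indVec F k {u}) = {x | P.le x u}.ncard := by
    rw [wt_indVec hk, idealGen_singleton]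
  have hsupp : ∀ i, indVec F k {u} i ≠ 0 ↔ i = u := by
    intro i
    have : i ∈ supp (indVec F k {u}) ↔ i ∈ ({u} : Set Ω) := by rw [supp_indVec hk]
    exact this
  have hideal : idealGen P {x | P.le x u} = {x | P.le x u} :=
    idealGen_eq_self fun a b hab hb => P.le_trans _ _ _ hab hb
  rw [hu, Set.mem_Iic, Set.mem_Iic]
  constructor
  · rintro ⟨h1, h2⟩ i hi
    by_contra hβ
    have key : ∀ ξ : Space F k, ξ u ≠ 0 → ξ i ≠ 0 → {x | P.le x u}.ncard < wt P ξ := by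
      intro ξ hξu hξi
      refine Set.ncard_lt_ncard ⟨fun x hx => ⟨u, hξu, hx⟩, fun hsub => ?_⟩
      exact hi (hsub ⟨i, hξi, P.le_refl i⟩)
    by_cases hβu : β u = 0
    · refine absurd (key (indVec F k {u} - β) ?_ ?_) (not_lt.2 h2)
      · rw [Pi.sub_apply, hβu, sub_zero]
        exact (hsupp u).2 rfl
      · have hiu : i ≠ u := fun h => hi (h ▸ P.le_refl i)
        have h0 : indVec F k {u} i = 0 := not_not.1 (mt (hsupp i).1 hiu)
        rw [Pi.sub_apply, h0, zero_sub]
        exact neg_ne_zero.2 hβ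
    · exact absurd (key β hβu hβ) (not_lt.2 h1)
  · intro h
    refine ⟨wt_le_ncard hideal fun i hi => ?_, wt_le_ncard hideal fun i hi => ?_⟩
    · by_contra hc
      exact hi (h i hc)
    · by_contra hc
      apply hi
      have hiu : i ≠ u := fun h => hc (by rw [h]; exact P.le_refl u)
      have h0 : indVec F k {u} i = 0 := not_not.1 (mt (hsupp i).1 hiu)
      rw [Pi.sub_apply, h0, h i hc, sub_zero]

theorem ncard_vanishing_off [DecidableEq Ω] (S : Finset Ω) :
    {β : Space F k | ∀ i, i ∉ S → β i = 0}.ncard = Fintype.card F ^ ∑ i ∈ S, k i := by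
  classical
  have e : {β : Space F k | ∀ i, i ∉ S → β i = 0} ≃ ((i : S) → (Fin (k i) → F)) :=
    { toFun := fun β i => β.1 i
      invFun := fun f => ⟨fun i => if hi : i ∈ S then f ⟨i, hi⟩ else 0, fun i hi => by simp [hi]⟩
      left_inv := by
        rintro ⟨β, hβ⟩
        ext i t
        by_cases hi : i ∈ S
        · simp [hi]
        · simp [hi, hβ i hi]
      right_inv := by
        intro f
        funext i
        simp }
  rw [← Nat.card_coe_set_eq, Nat.card_congr e, Nat.card_eq_fintype_card, Fintype.card_pi,
    ← Finset.prod_pow_eq_pow_sum, ← Finset.prod_coe_sort S]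
  simp

theorem HasIntersectionNumbers.conditionE (hk : ∀ i, 0 < k i) {P : PartialOrder Ω}
    (h : HasIntersectionNumbers F k P) : ConditionE F k P := by
  classical
  have hH : IsHierarchical P := fun u v huv =>
    h.le_of_len_lt hk (len P u) u v le_rfl huv
  refine ⟨hH, fun u v huv => ?_⟩
  have hbelow : ∀ u : Ω, {x | P.le x u} = insert u {x | len P x < len P u} := by
    intro u
    ext x
    exact hH.le_iff
  have hmem : ∀ u : Ω, u ∉ {x | len P x < len P u} := fun u h => lt_irrefl (len P u) h
  have hwt : wt P (indVec F k {u}) = wt P (indVec F k {v}) := by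
    rw [wt_indVec hk, wt_indVec hk, idealGen_singleton, idealGen_singleton, hbelow, hbelow,
      Set.ncard_insert_of_notMem (hmem u), Set.ncard_insert_of_notMem (hmem v), huv]
  have h1 := h _ _ hwt (Set.Iic (wt P (indVec F k {u}))) (Set.Iic (wt P (indVec F k {u})))
  -- The intersection number counts the vectors supported on the ideal of `u`, which consists of `u`
  -- and all lower levels. For two points of one level, only the dimensions at the points themselves
  -- can differ.
  have h2 : ∀ u : Ω, {β : Space F k | wt P β ∈ Set.Iic (wt P (indVec F k {u})) ∧
      wt P (indVec F k {u} - β) ∈ Set.Iic (wt P (indVec F k {u}))}.ncard =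
      Fintype.card F ^ (k u + ∑ i with len P i < len P u, k i) := by
    intro u
    have h3 : k u + ∑ i with len P i < len P u, k i =
        ∑ i ∈ insert u (Finset.univ.filter fun i => len P i < len P u), k i := by
      rw [Finset.sum_insert (by simp)]
    rw [h3, ← ncard_vanishing_off]
    congr 1
    ext β
    rw [Set.mem_ofPred_eq, wt_le_and_wt_sub_le_iff hk]
    simp [hH.le_iff]
  rw [h2, hwt, h2, huv] at h1
  have h4 := Nat.pow_right_injective (Fintype.one_lt_card (α := F)) h1
  have h5 : k u = k v := by simpa using h4
  rw [h5]
  exact ⟨LinearEquiv.refl F _⟩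

end PosetWeight

/-! ### Linear algebra and the counting of subspaces. -/

namespace PosetWeight

/-! ### Linear maps with equal kernels -/

/-- Two linear maps with the same kernel, into spaces of the same finite dimension, differ by an
isomorphism of these spaces. -/
theorem exists_linearEquiv_of_ker_eq {F V A B : Type*} [Field F] [AddCommGroup V] [Module F V]
    [AddCommGroup A] [Module F A] [AddCommGroup B] [Module F B] [FiniteDimensional F A]
    [FiniteDimensional F B] (f : V →ₗ[F] A) (g : V →ₗ[F] B)
    (h : LinearMap.ker f = LinearMap.ker g) (hAB : Module.finrank F A = Module.finrank F B) :
    ∃ T : A ≃ₗ[F] B, ∀ v, T (f v) = g v := by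
  obtain ⟨A', hA'⟩ := Submodule.exists_isCompl (LinearMap.range f)
  obtain ⟨B', hB'⟩ := Submodule.exists_isCompl (LinearMap.range g)
  let e : LinearMap.range f ≃ₗ[F] LinearMap.range g :=
    (f.quotKerEquivRange.symm.trans (Submodule.quotEquivOfEq _ _ h)).trans g.quotKerEquivRange
  have he : ∀ v, e ⟨f v, v, rfl⟩ = ⟨g v, v, rfl⟩ := by
    intro v
    have h1 : f.quotKerEquivRange.symm ⟨f v, v, rfl⟩ = Submodule.Quotient.mk v := by
      rw [LinearEquiv.symm_apply_eq]; rfl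
    simp only [e, LinearEquiv.trans_apply, h1, Submodule.quotEquivOfEq_mk]
    rfl
  have h1 := Submodule.finrank_add_eq_of_isCompl hA'
  have h2 := Submodule.finrank_add_eq_of_isCompl hB'
  have h3 := e.finrank_eq
  let e' : A' ≃ₗ[F] B' := LinearEquiv.ofFinrankEq A' B' (by omega)
  refine ⟨((Submodule.prodEquivOfIsCompl _ _ hA').symm.trans (e.prodCongr e')).trans
    (Submodule.prodEquivOfIsCompl _ _ hB'), fun v => ?_⟩
  have h4 : (Submodule.prodEquivOfIsCompl _ _ hA').symm (f v) = (⟨f v, v, rfl⟩, 0) :=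
    Submodule.prodEquivOfIsCompl_symm_apply_left _ _ hA' ⟨f v, v, rfl⟩
  simp [LinearEquiv.trans_apply, h4, he]

/-- `T` is the transpose of an isomorphism carrying `α` to `γ`. -/
theorem exists_linearEquiv_dotProduct {F : Type*} [Field F] {m n : ℕ} (hmn : m = n)
    (α : Fin m → F) (γ : Fin n → F) (h : α = 0 ↔ γ = 0) :
    ∃ T : (Fin n → F) ≃ₗ[F] (Fin m → F), ∀ x, α ⬝ᵥ T x = γ ⬝ᵥ x := by
  subst hmn
  obtain ⟨S, hS⟩ := exists_linearEquiv_of_ker_eq (LinearMap.toSpanSingleton F _ α)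
    (LinearMap.toSpanSingleton F _ γ) (by
      ext t
      by_cases ht : t = 0
      · simp [ht]
      · simp [ht, h]) rfl
  have hS1 : S α = γ := by simpa using hS 1
  set M := LinearMap.toMatrix' (S : (Fin m → F) →ₗ[F] (Fin m → F))
  set M' := LinearMap.toMatrix' (S.symm : (Fin m → F) →ₗ[F] (Fin m → F))
  have h1 : M * M' = 1 := by
    rw [← LinearMap.toMatrix'_comp]; simp
  have h2 : M' * M = 1 := by
    rw [← LinearMap.toMatrix'_comp]; simp
  refine ⟨Matrix.toLin'OfInv (M := M'.transpose) (M' := M.transpose)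
    (by rw [← Matrix.transpose_mul, h1, Matrix.transpose_one])
    (by rw [← Matrix.transpose_mul, h2, Matrix.transpose_one]), fun x => ?_⟩
  have h3 : M.mulVec α = γ := by
    rw [← hS1]; exact LinearMap.toMatrix'_mulVec _ _
  change α ⬝ᵥ M.transpose.mulVec x = _
  rw [Matrix.dotProduct_mulVec, Matrix.vecMul_transpose, h3]

/-- A function with the same fibre cardinalities as another one is obtained from it by a
permutation of the domain. -/
theorem exists_perm_of_fiber_card_eq {X Y : Type*} [Finite X] (f g : X → Y)
    (h : ∀ y, {x | f x = y}.ncard = {x | g x = y}.ncard) :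
    ∃ τ : Equiv.Perm X, ∀ x, f (τ x) = g x := by
  let e : ∀ y, {x // g x = y} ≃ {x // f x = y} := fun y =>
    Classical.choice (Finite.card_eq.1 (h y).symm)
  refine ⟨((Equiv.sigmaFiberEquiv g).symm.trans (Equiv.sigmaCongrRight e)).trans
    (Equiv.sigmaFiberEquiv f), fun x => ?_⟩
  exact (e (g x) ⟨x, rfl⟩).2

/-! ### Multisets of subspaces -/

section

variable {F V : Type*} [Field F] [Fintype F] [AddCommGroup V] [Module F V] [Fintype V]

theorem card_mul_card_inf_le {U W : Submodule F V} (h : ¬ W ≤ U) :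
    Fintype.card F * Nat.card ↥(U ⊓ W) ≤ Nat.card W := by
  have h1 : Module.finrank F ↥(U ⊓ W) < Module.finrank F W :=
    Submodule.finrank_lt_finrank_of_lt (lt_of_le_of_ne inf_le_right fun h2 => h (inf_eq_right.1 h2))
  rw [Module.natCard_eq_pow_finrank (K := F), Module.natCard_eq_pow_finrank (K := F) (V := W),
    Nat.card_eq_fintype_card, ← pow_succ']
  exact Nat.pow_le_pow_right Fintype.card_pos h1

open Classical in
-- Double count of the pairs of a vector of `W` and a member of `M` containing it.
theorem sum_countP_mem (M : Multiset (Submodule F V)) (W : Submodule F V) :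
    ∑ v : W, M.countP (fun U => (v : V) ∈ U) = (M.map fun U => Nat.card ↥(U ⊓ W)).sum := by
  induction M using Multiset.induction_on with
  | empty => simp
  | cons U M ih =>
    simp only [Multiset.countP_cons, Finset.sum_add_distrib, ih, Multiset.map_cons,
      Multiset.sum_cons]
    rw [add_comm]
    congr 1
    rw [← Finset.sum_filter, Finset.sum_const, smul_eq_mul, mul_one,
      ← Nat.subtype_card (p := fun v : W => (v : V) ∈ U) _ (by simp)]
    refine Nat.card_congr
      { toFun := fun v => ⟨v.1.1, v.2, v.1.2⟩
        invFun := fun v => ⟨⟨v.1, v.2.2⟩, v.2.1⟩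
        left_inv := fun v => rfl
        right_inv := fun v => rfl }

theorem card_mul_sum_le {M : Multiset (Submodule F V)} {W : Submodule F V}
    (h : ∀ U ∈ M, ¬ W ≤ U) :
    Fintype.card F * (M.map fun U => Nat.card ↥(U ⊓ W)).sum ≤ M.card * Nat.card W := by
  rw [← Multiset.sum_map_mul_left, ← smul_eq_mul, ← Multiset.card_map
    (fun U => Fintype.card F * Nat.card ↥(U ⊓ W)) M]
  refine Multiset.sum_le_card_nsmul _ _ ?_
  simp only [Multiset.mem_map, forall_exists_index, and_imp]
  rintro _ U hU rfl
  exact card_mul_card_inf_le (h U hU)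

open Classical in
-- Otherwise no member of `M'` contains `W`, so each meets it in at most `|W| / q` vectors and the
-- incidences with `W` number at most `|M| |W| / q`. The same number computed from `M` is larger,
-- because `W` itself occurs there.
theorem mem_of_countP_mem_eq {M M' : Multiset (Submodule F V)} (hcard : M.card = M'.card)
    (hcount : ∀ v, M.countP (fun U => v ∈ U) = M'.countP (fun U => v ∈ U))
    (h : (∀ U ∈ M, ∀ W ∈ M, Nat.card W ≤ Fintype.card F * Nat.card ↥(U ⊓ W)) ∨
      M.card ≤ Fintype.card F)
    {W : Submodule F V} (hW : W ∈ M) (hmax : ∀ U ∈ M', W ≤ U → U = W) : W ∈ M' := by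
  by_contra hWM
  have hnle : ∀ U ∈ M', ¬ W ≤ U := fun U hU hle => hWM (hmax U hU hle ▸ hU)
  have h1 := card_mul_sum_le hnle
  have hq := Fintype.one_lt_card (α := F)
  have hpos : 0 < Nat.card W := Nat.card_pos
  have hN : 0 < M.card := Multiset.card_pos_iff_exists_mem.2 ⟨W, hW⟩
  rw [← sum_countP_mem, ← Finset.sum_congr rfl fun (v : W) _ => hcount (v : V), ← hcard] at h1
  rcases h with h | h
  · rw [sum_countP_mem] at h1
    obtain ⟨N, rfl⟩ := Multiset.exists_cons_of_mem hW
    have h2 : N.card * Nat.card W ≤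
        Fintype.card F * (N.map fun U => Nat.card ↥(U ⊓ W)).sum := by
      rw [← Multiset.sum_map_mul_left, ← smul_eq_mul, ← Multiset.card_map
        (fun U => Fintype.card F * Nat.card ↥(U ⊓ W)) N]
      refine Multiset.card_nsmul_le_sum ?_
      simp only [Multiset.mem_map, forall_exists_index, and_imp]
      rintro _ U hU rfl
      exact h U (Multiset.mem_cons_of_mem hU) W hW
    rw [Multiset.map_cons, Multiset.sum_cons, inf_idem, Multiset.card_cons, mul_add] at h1
    nlinarith
  -- Every vector of `W` is covered by `W`, and the zero vector by all members of `M`; this exceeds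
  -- the upper bound when `M` has at most `q` members.
  · have h2 : Nat.card W - 1 + M.card ≤ ∑ v : W, M.countP (fun U => (v : V) ∈ U) := by
      rw [← Finset.sum_erase_add _ _ (Finset.mem_univ (0 : W))]
      have h0 : M.countP (fun U => ((0 : W) : V) ∈ U) = M.card :=
        Multiset.countP_eq_card.2 fun U _ => U.zero_mem
      rw [h0]
      refine Nat.add_le_add_right ?_ _
      have h3 : Nat.card W - 1 = ∑ v ∈ Finset.univ.erase (0 : W), 1 := by
        rw [Finset.sum_const, smul_eq_mul, mul_one, Finset.card_erase_of_mem (Finset.mem_univ _),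
          Nat.card_eq_fintype_card, Finset.card_univ]
      rw [h3]
      exact Finset.sum_le_sum fun v _ => Multiset.countP_pos.2 ⟨W, hW, v.2⟩
    obtain ⟨c, hc⟩ : ∃ c, Nat.card W = c + 1 := ⟨Nat.card W - 1, by omega⟩
    rw [hc] at h1 h2
    rw [Nat.add_sub_cancel] at h2
    have h4 := (Nat.mul_le_mul_left (Fintype.card F) h2).trans h1
    nlinarith [Nat.mul_le_mul_right c h]

open Classical in
/-- A multiset of subspaces is determined by the number of its members that contain each given
vector, if it is small or if its members have codimension at most one in each other. -/
theorem eq_of_countP_mem_eq {M M' : Multiset (Submodule F V)} (hcard : M.card = M'.card)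
    (hcount : ∀ v, M.countP (fun U => v ∈ U) = M'.countP (fun U => v ∈ U))
    (h : (∀ U ∈ M, ∀ W ∈ M, Nat.card W ≤ Fintype.card F * Nat.card ↥(U ⊓ W)) ∧
        (∀ U ∈ M', ∀ W ∈ M', Nat.card W ≤ Fintype.card F * Nat.card ↥(U ⊓ W)) ∨
      M.card ≤ Fintype.card F) : M = M' := by
  induction hn : M.card generalizing M M' with
  | zero =>
    rw [Multiset.card_eq_zero.1 hn, Multiset.card_eq_zero.1 (hcard.symm.trans hn)]
  | succ n ih =>
    -- A subspace maximal in both multisets together lies in both, and can be cancelled.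
    obtain ⟨W, hW, hmax⟩ : ∃ W ∈ M + M', ∀ U ∈ M + M', W ≤ U → U = W := by
      have hne : ((M + M').toFinset : Set (Submodule F V)).Nonempty := by
        obtain ⟨W, hW⟩ := Multiset.card_pos_iff_exists_mem.1 (show 0 < M.card by omega)
        exact ⟨W, by simp [hW]⟩
      obtain ⟨W, hW, hmax⟩ := (Set.toFinite _).exists_maximalFor id _ hne
      refine ⟨W, by simpa using hW, fun U hU hWU => le_antisymm (hmax (by simpa using hU) hWU) hWU⟩
    have hboth : W ∈ M ∧ W ∈ M' := by
      rcases Multiset.mem_add.1 hW with hW | hW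
      · exact ⟨hW, mem_of_countP_mem_eq hcard hcount (h.imp_left And.left) hW
          fun U hU => hmax U (Multiset.mem_add.2 (Or.inr hU))⟩
      · exact ⟨mem_of_countP_mem_eq hcard.symm (fun v => (hcount v).symm)
          (h.imp And.right (hcard ▸ ·)) hW
          fun U hU => hmax U (Multiset.mem_add.2 (Or.inl hU)), hW⟩
    obtain ⟨N, rfl⟩ := Multiset.exists_cons_of_mem hboth.1
    obtain ⟨N', rfl⟩ := Multiset.exists_cons_of_mem hboth.2
    rw [Multiset.card_cons] at hn
    rw [Multiset.card_cons, Multiset.card_cons] at hcard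
    refine congrArg (W ::ₘ ·) (ih (M := N) (M' := N') (by omega) (fun v => ?_) ?_ (by omega))
    · have := hcount v
      rw [Multiset.countP_cons, Multiset.countP_cons] at this
      omega
    · refine h.imp (fun h => ⟨fun U hU W hW => ?_, fun U hU W hW => ?_⟩) fun h => ?_
      · exact h.1 U (Multiset.mem_cons_of_mem hU) W (Multiset.mem_cons_of_mem hW)
      · exact h.2 U (Multiset.mem_cons_of_mem hU) W (Multiset.mem_cons_of_mem hW)
      · rw [Multiset.card_cons] at h
        omega

end

end PosetWeight

/-! ### Hierarchical posets: weights by level, extension and adjoints. -/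

namespace PosetWeight

variable {Ω : Type*} [Fintype Ω]
variable {F : Type*} [Field F] {k : Ω → ℕ}

/-! ### Weights for a poset defined by a rank function -/

section

variable {L : Type*} [LinearOrder L] {ℓ : Ω → L} {P : PartialOrder Ω}

/-- The rank takes values in an arbitrary linear order, so that the results serve `P` with `len` and
the dual poset with `len` reversed. -/
theorem exists_top {x : Space F k} (ℓ : Ω → L) (hx : x ≠ 0) :
    ∃ i, x i ≠ 0 ∧ ∀ j, ℓ i < ℓ j → x j = 0 := by
  obtain ⟨i, hi⟩ := Function.ne_iff.1 hx
  obtain ⟨j, hj, hmax⟩ := (Set.toFinite (supp x)).exists_maximalFor ℓ _ ⟨i, hi⟩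
  refine ⟨j, hj, fun l hl => ?_⟩
  by_contra hc
  exact absurd (hmax (j := l) hc hl.le) (not_le.2 hl)

theorem idealGen_supp_eq (hP : ∀ u v, P.le u v ↔ u = v ∨ ℓ u < ℓ v) {x : Space F k} {i : Ω}
    (hi : x i ≠ 0) (htop : ∀ j, ℓ i < ℓ j → x j = 0) :
    idealGen P (supp x) = {j | ℓ j < ℓ i} ∪ {j | ℓ j = ℓ i ∧ x j ≠ 0} := by
  ext j
  constructor
  · rintro ⟨b, hb, hjb⟩
    have hb1 : ℓ b ≤ ℓ i := not_lt.1 fun h => hb (htop b h)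
    rcases (hP _ _).1 hjb with rfl | h
    · rcases hb1.lt_or_eq with h | h
      · exact Or.inl h
      · exact Or.inr ⟨h, hb⟩
    · exact Or.inl (h.trans_le hb1)
  · rintro (h | ⟨-, h⟩)
    · exact ⟨i, hi, (hP _ _).2 (Or.inr h)⟩
    · exact ⟨j, h, P.le_refl j⟩

/-- The weight sees only the top occupied level and the number of nonzero blocks on it, so zero
patterns need to be matched only on levels above which `x` vanishes. -/
theorem wt_eq_of_perm (hP : ∀ u v, P.le u v ↔ u = v ∨ ℓ u < ℓ v) (τ : Equiv.Perm Ω)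
    (hτ : ∀ j, ℓ (τ j) = ℓ j) {x y : Space F k}
    (h : ∀ r, (∀ i, r < ℓ i → x i = 0) → ∀ j, r ≤ ℓ j → (y j = 0 ↔ x (τ j) = 0)) :
    wt P y = wt P x := by
  by_cases hx : x = 0
  · have hy : y = 0 := by
      funext j
      exact (h (ℓ j) (fun i _ => by rw [hx]; rfl) j le_rfl).2 (by rw [hx]; rfl)
    rw [hx, hy]
  obtain ⟨i, hi, htop⟩ := exists_top ℓ hx
  have hli : ℓ (τ.symm i) = ℓ i := by rw [← hτ, τ.apply_symm_apply]
  have hyi : y (τ.symm i) ≠ 0 := by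
    rw [Ne, h (ℓ i) htop _ hli.ge, τ.apply_symm_apply]
    exact hi
  have hytop : ∀ j, ℓ (τ.symm i) < ℓ j → y j = 0 := fun j hj => by
    rw [hli] at hj
    exact (h (ℓ i) htop j hj.le).2 (htop _ (by rwa [hτ]))
  rw [wt, wt, idealGen_supp_eq hP hi htop, idealGen_supp_eq hP hyi hytop, hli,
    ← Set.ncard_image_of_injective _ τ.injective]
  congr 1
  ext j
  rw [Equiv.image_eq_preimage_symm]
  have hlj : ℓ (τ.symm j) = ℓ j := by rw [← hτ, τ.apply_symm_apply]
  simp only [Set.mem_preimage, Set.mem_union, Set.mem_ofPred_eq, hlj]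
  refine or_congr Iff.rfl (and_congr_right fun hj => ?_)
  rw [Ne, Ne, h (ℓ i) htop _ (by rw [hlj, hj]), τ.apply_symm_apply]

theorem wt_le_iff (hP : ∀ u v, P.le u v ↔ u = v ∨ ℓ u < ℓ v) (x : Space F k) (r : L) :
    wt P x ≤ {j | ℓ j ≤ r}.ncard ↔ ∀ i, r < ℓ i → x i = 0 := by
  constructor
  · intro h i hi
    by_contra hx
    refine absurd (Set.ncard_lt_ncard ?_) (not_lt.2 h)
    refine ⟨fun j hj => ⟨i, hx, (hP _ _).2 (Or.inr (lt_of_le_of_lt hj hi))⟩, fun hsub => ?_⟩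
    exact absurd (hsub ⟨i, hx, P.le_refl i⟩) (not_le.2 hi)
  · intro h
    refine wt_le_ncard (idealGen_eq_self fun a b hab hb => ?_) fun i hi => ?_
    · rcases (hP _ _).1 hab with rfl | hab
      · exact hb
      · exact hab.le.trans hb
    · by_contra hc
      exact hi (h i (not_le.1 hc))

/-- If `x` also vanishes on level `r`, its weight is at most the number of points below, and the
truncated difference is correctly `0`. -/
theorem ncard_top_level (hP : ∀ u v, P.le u v ↔ u = v ∨ ℓ u < ℓ v) {x : Space F k} {r : L}
    (h : ∀ i, r < ℓ i → x i = 0) :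
    {j | ℓ j = r ∧ x j ≠ 0}.ncard = wt P x - {j | ℓ j < r}.ncard := by
  by_cases hr : ∃ i, ℓ i = r ∧ x i ≠ 0
  · obtain ⟨i, rfl, hi⟩ := hr
    rw [wt, idealGen_supp_eq hP hi h, Set.ncard_union_eq, Nat.add_sub_cancel_left]
    rw [Set.disjoint_left]
    intro j hj hj'
    exact absurd hj'.1 (ne_of_lt hj)
  · have h1 : {j | ℓ j = r ∧ x j ≠ 0} = ∅ := by
      ext j
      simp only [Set.mem_ofPred_eq, Set.mem_empty_iff_false, iff_false]
      exact fun hj => hr ⟨j, hj⟩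
    rw [h1, Set.ncard_empty]
    refine (Nat.sub_eq_zero_of_le (wt_le_ncard (idealGen_eq_self fun a b hab hb => ?_)
      fun i hi => ?_)).symm
    · rcases (hP _ _).1 hab with rfl | hab
      · exact hb
      · exact hab.trans hb
    · by_contra hc
      rcases (not_lt.1 hc).eq_or_lt with h2 | h2
      · exact hr ⟨i, h2.symm, hi⟩
      · exact hi (h i h2)

theorem ncard_level_eq_zero (x : Space F k) (r : L) :
    {j | ℓ j = r ∧ x j = 0}.ncard = {j | ℓ j = r}.ncard - {j | ℓ j = r ∧ x j ≠ 0}.ncard := by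
  rw [← Set.ncard_sdiff (fun j hj => hj.1)]
  congr 1
  ext j
  by_cases hj : ℓ j = r <;> simp [hj]

theorem ncard_level_congr (hP : ∀ u v, P.le u v ↔ u = v ∨ ℓ u < ℓ v) {x y : Space F k} {r : L}
    (hx : ∀ i, r < ℓ i → x i = 0) (hxy : wt P x = wt P y) :
    (∀ i, r < ℓ i → y i = 0) ∧
      {j | ℓ j = r ∧ x j ≠ 0}.ncard = {j | ℓ j = r ∧ y j ≠ 0}.ncard ∧
      {j | ℓ j = r ∧ x j = 0}.ncard = {j | ℓ j = r ∧ y j = 0}.ncard := by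
  have hy : ∀ i, r < ℓ i → y i = 0 := by
    rwa [← wt_le_iff hP, ← hxy, wt_le_iff hP]
  have h1 : {j | ℓ j = r ∧ x j ≠ 0}.ncard = {j | ℓ j = r ∧ y j ≠ 0}.ncard := by
    rw [ncard_top_level hP hx, ncard_top_level hP hy, hxy]
  exact ⟨hy, h1, by rw [ncard_level_eq_zero, ncard_level_eq_zero, h1]⟩

end

/-! ### Extension of weight-preserving maps -/

theorem exists_linearMap_comp_eq {V A B : Type*} [AddCommGroup V] [Module F V]
    [AddCommGroup A] [Module F A] [AddCommGroup B] [Module F B] (f : V →ₗ[F] A) (g : V →ₗ[F] B)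
    (h : LinearMap.ker f ≤ LinearMap.ker g) : ∃ N : A →ₗ[F] B, ∀ v, N (f v) = g v := by
  obtain ⟨N, hN⟩ := LinearMap.exists_extend
    (((LinearMap.ker f).liftQ g h).comp f.quotKerEquivRange.symm.toLinearMap)
  refine ⟨N, fun v => ?_⟩
  have h1 : f.quotKerEquivRange.symm ⟨f v, v, rfl⟩ = Submodule.Quotient.mk v := by
    rw [LinearEquiv.symm_apply_eq]; rfl
  have h2 := LinearMap.congr_fun hN ⟨f v, v, rfl⟩
  rw [LinearMap.comp_apply, LinearMap.comp_apply, LinearEquiv.coe_coe, h1,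
    Submodule.liftQ_apply] at h2
  exact h2

/-- The linear map that erases the coordinates of level at most `r`. -/
noncomputable def eraseUpTo (F : Type*) [Field F] (k : Ω → ℕ) (P : PartialOrder Ω) (r : ℕ) :
    Space F k →ₗ[F] Space F k :=
  LinearMap.pi fun i => if r < len P i then LinearMap.proj i else 0

theorem eraseUpTo_eq_zero {P : PartialOrder Ω} {r : ℕ} {x : Space F k} :
    eraseUpTo F k P r x = 0 ↔ ∀ i, r < len P i → x i = 0 := by
  rw [funext_iff]
  refine forall_congr' fun i => ?_
  by_cases hi : r < len P i <;> simp [eraseUpTo, hi]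

/-- The extension is block triangular: on block `j`, apply `T j` to block `τ j` and add a correction
depending only on higher levels. The correction exists because `f` minus the block part kills
codewords vanishing above, and it does not affect the weight. -/
theorem IsHierarchical.exists_extension [Finite F] {P : PartialOrder Ω} (hP : IsHierarchical P)
    (C : Submodule F (Space F k)) (f : C →ₗ[F] Space F k) (τ : Equiv.Perm Ω)
    (hτ : ∀ j, len P (τ j) = len P j) (T : ∀ j, (Fin (k (τ j)) → F) ≃ₗ[F] (Fin (k j) → F))
    (hT : ∀ j (c : C), (∀ i, len P j < len P i → (c : Space F k) i = 0) →
      f c j = T j ((c : Space F k) (τ j))) :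
    ∃ φ : Space F k ≃ₗ[F] Space F k, (∀ α, wt P (φ α) = wt P α) ∧ ∀ α : C, φ α = f α := by
  have hN : ∀ j, ∃ N : Space F k →ₗ[F] (Fin (k j) → F), ∀ c : C,
      N (eraseUpTo F k P (len P j) c) = f c j - T j ((c : Space F k) (τ j)) := by
    intro j
    refine exists_linearMap_comp_eq ((eraseUpTo F k P (len P j)).comp C.subtype)
      ((LinearMap.proj j).comp f -
        ((T j).toLinearMap.comp (LinearMap.proj (τ j))).comp C.subtype) fun c hc => ?_
    have := hT j c (eraseUpTo_eq_zero.1 hc)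
    rw [LinearMap.mem_ker]
    simp [this]
  choose N hN using hN
  let φ : Space F k →ₗ[F] Space F k := LinearMap.pi fun j =>
    (T j).toLinearMap.comp (LinearMap.proj (τ j)) + (N j).comp (eraseUpTo F k P (len P j))
  have hφ : ∀ x j, φ x j = T j (x (τ j)) + N j (eraseUpTo F k P (len P j) x) := fun x j => rfl
  have hwt : ∀ x, wt P (φ x) = wt P x := by
    intro x
    refine wt_eq_of_perm (fun u v => hP.le_iff) τ hτ fun r hr j hj => ?_
    rw [hφ, eraseUpTo_eq_zero.2 fun i hi => hr i (hj.trans_lt hi), map_zero, add_zero,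
      LinearEquiv.map_eq_zero_iff]
  obtain ⟨ψ, hψ⟩ := exists_equiv_of_wt_preserving φ hwt
  refine ⟨ψ, fun α => by rw [hψ, hwt], fun c => ?_⟩
  rw [hψ]
  funext j
  rw [hφ, hN, add_sub_cancel]

theorem natCard_le_of_finrank_range_le_one {V B : Type*} [Fintype F] [AddCommGroup V]
    [Module F V] [Finite V] [AddCommGroup B] [Module F B] (U W : Submodule F V) (g : V →ₗ[F] B)
    (hU : ∀ v ∈ W, v ∈ U ↔ g v = 0)
    (hg : Module.finrank F (LinearMap.range (g.domRestrict W)) ≤ 1) :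
    Nat.card W ≤ Fintype.card F * Nat.card ↥(U ⊓ W) := by
  have h1 := LinearMap.finrank_range_add_finrank_ker (g.domRestrict W)
  have h2 : (LinearMap.ker (g.domRestrict W)).map W.subtype = U ⊓ W := by
    ext v
    simp only [Submodule.mem_map, LinearMap.mem_ker, LinearMap.domRestrict_apply,
      Submodule.subtype_apply, Submodule.mem_inf]
    constructor
    · rintro ⟨w, hw, rfl⟩
      exact ⟨(hU w w.2).2 hw, w.2⟩
    · rintro ⟨hvU, hvW⟩
      exact ⟨⟨v, hvW⟩, (hU v hvW).1 hvU, rfl⟩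
  have h3 := Submodule.finrank_map_subtype_eq W (LinearMap.ker (g.domRestrict W))
  rw [h2] at h3
  rw [Module.natCard_eq_pow_finrank (K := F), Module.natCard_eq_pow_finrank (K := F)
    (V := ↥(U ⊓ W)), Nat.card_eq_fintype_card, ← pow_succ']
  exact Nat.pow_le_pow_right Fintype.card_pos (by omega)

theorem ConditionE.dim_eq {P : PartialOrder Ω} (hE : ConditionE F k P) {u v : Ω}
    (h : len P u = len P v) : k u = k v := by
  obtain ⟨e⟩ := hE.2 u v h
  simpa using e.finrank_eq

/-- The codewords that vanish above level `r` and are annihilated by `g`. -/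
def levelKer {P : PartialOrder Ω} {C : Submodule F (Space F k)} {n : ℕ} (r : ℕ)
    (g : C →ₗ[F] (Fin n → F)) : Submodule F C where
  carrier := {c | (∀ i, r < len P i → (c : Space F k) i = 0) ∧ g c = 0}
  zero_mem' := ⟨fun _ _ => rfl, map_zero g⟩
  add_mem' := fun {a b} ha hb =>
    ⟨fun i hi => by simp [ha.1 i hi, hb.1 i hi], by rw [map_add, ha.2, hb.2, add_zero]⟩
  smul_mem' := fun t a ha => ⟨fun i hi => by simp [ha.1 i hi], by rw [map_smul, ha.2, smul_zero]⟩

theorem ncard_level_fiber_eq {ι Y : Type*} [Fintype ι] {l : ι → ℕ} {r : ℕ} {A B : ι → Y}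
    (h : ((Finset.univ.filter fun j => l j = r).val.map A) =
      ((Finset.univ.filter fun j => l j = r).val.map B)) (y : Y) :
    {j | l j = r ∧ A j = y}.ncard = {j | l j = r ∧ B j = y}.ncard := by
  classical
  have h1 := congrArg (Multiset.count y) h
  rw [Multiset.count_map, Multiset.count_map] at h1
  have key : ∀ A : ι → Y, {j | l j = r ∧ A j = y}.ncard =
      (((Finset.univ.filter fun j => l j = r).val).filter fun a => y = A a).card := by
    intro A
    rw [Set.ncard_eq_toFinset_card', ← Finset.filter_val, Finset.card_val]
    congr 1
    ext j
    simp [eq_comm]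
  rw [key, key, h1]

/-- For a codeword vanishing above level `r`, the number of subspaces `A j` on that level containing
it is its number of zero blocks there; `B j` counts the zero blocks of its image. Equal weights make
these agree, so the two multisets coincide. Equal kernels then give the block isomorphisms. -/
theorem ConditionE.exists_matching [Fintype F] {P : PartialOrder Ω} (hE : ConditionE F k P)
    (C : Submodule F (Space F k)) (f : C →ₗ[F] Space F k)
    (hf : ∀ α : C, wt P (f α) = wt P (α : Space F k))
    (hlev : ∀ r, (∀ i, len P i = r → k i = 1) ∨ Module.finrank F C ≤ 1 ∨
      {i | len P i = r}.ncard ≤ Fintype.card F) :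
    ∃ τ : Equiv.Perm Ω, (∀ j, len P (τ j) = len P j) ∧
      ∀ j, ∃ T : (Fin (k (τ j)) → F) ≃ₗ[F] (Fin (k j) → F),
        ∀ c : C, (∀ i, len P j < len P i → (c : Space F k) i = 0) →
          f c j = T ((c : Space F k) (τ j)) := by
  classical
  have hP : ∀ u v, P.le u v ↔ u = v ∨ len P u < len P v := fun u v => hE.1.le_iff
  let a (j : Ω) : C →ₗ[F] (Fin (k j) → F) := (LinearMap.proj j).comp C.subtype
  let b (j : Ω) : C →ₗ[F] (Fin (k j) → F) := (LinearMap.proj j).comp f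
  let A (j : Ω) : Submodule F C := levelKer (P := P) (len P j) (a j)
  let B (j : Ω) : Submodule F C := levelKer (P := P) (len P j) (b j)
  have hM : ∀ r, ((Finset.univ.filter fun j => len P j = r).val.map A) =
      ((Finset.univ.filter fun j => len P j = r).val.map B) := by
    intro r
    have hcount : ∀ (D : Ω → Submodule F C) (v : C),
        ((Finset.univ.filter fun j => len P j = r).val.map D).countP (fun U => v ∈ U) =
          {j | len P j = r ∧ v ∈ D j}.ncard := by
      intro D v
      rw [Multiset.countP_map, ← Finset.filter_val, Finset.card_val, Finset.filter_filter,
        Set.ncard_eq_toFinset_card']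
      congr 1
      ext j
      simp
    have hcodim : ∀ g : ∀ j, C →ₗ[F] (Fin (k j) → F),
        ((∀ i, len P i = r → k i = 1) ∨ Module.finrank F C ≤ 1) →
        ∀ U ∈ ((Finset.univ.filter fun j => len P j = r).val.map
            fun j => levelKer (P := P) (len P j) (g j)),
          ∀ W ∈ ((Finset.univ.filter fun j => len P j = r).val.map
            fun j => levelKer (P := P) (len P j) (g j)),
          Nat.card W ≤ Fintype.card F * Nat.card ↥(U ⊓ W) := by
      intro g h U hU W hW
      simp only [Multiset.mem_map, Finset.mem_val, Finset.mem_filter, Finset.mem_univ,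
        true_and] at hU hW
      obtain ⟨j, hj, rfl⟩ := hU
      obtain ⟨j', hj', rfl⟩ := hW
      refine natCard_le_of_finrank_range_le_one _ _ (g j) (fun v hv => ?_) ?_
      · refine ⟨fun h => h.2, fun h => ⟨?_, h⟩⟩
        rw [hj, ← hj']
        exact hv.1
      · rcases h with h | h
        · refine (Submodule.finrank_le _).trans ?_
          rw [Module.finrank_fin_fun, h j hj]
        · exact (LinearMap.finrank_range_le _).trans ((Submodule.finrank_le _).trans h)
    refine eq_of_countP_mem_eq (by simp) (fun v => ?_) ?_
    · rw [hcount, hcount]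
      by_cases hv : ∀ i, r < len P i → (v : Space F k) i = 0
      · have h1 := (ncard_level_congr hP hv (hf v).symm).2.2
        refine Eq.trans ?_ (h1.trans ?_) <;>
        · congr 1
          ext j
          simp only [Set.mem_ofPred_eq]
          refine and_congr_right fun hj => ?_
          subst hj
          first
          | exact ⟨fun h => h.2, fun h => ⟨hv, h⟩⟩
          | exact ⟨fun h => ⟨hv, h⟩, fun h => h.2⟩
      · congr 1
        ext j
        simp only [Set.mem_ofPred_eq]
        refine and_congr_right fun hj => ?_
        subst hj
        exact ⟨fun h => absurd h.1 hv, fun h => absurd h.1 hv⟩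
    · rcases hlev r with h | h | h
      · exact Or.inl ⟨hcodim a (Or.inl h), hcodim b (Or.inl h)⟩
      · exact Or.inl ⟨hcodim a (Or.inr h), hcodim b (Or.inr h)⟩
      · refine Or.inr ?_
        rw [Multiset.card_map, Finset.card_val]
        rwa [Set.ncard_eq_toFinset_card', Set.toFinset_ofPred] at h
  -- Pairing with the level forces the permutation to preserve levels.
  obtain ⟨τ, hτ⟩ := exists_perm_of_fiber_card_eq (fun j => (len P j, A j))
    (fun j => (len P j, B j)) fun y => by
      simp only [Prod.ext_iff]
      exact ncard_level_fiber_eq (hM y.1) y.2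
  have hτ1 : ∀ j, len P (τ j) = len P j := fun j => congrArg Prod.fst (hτ j)
  have hτ2 : ∀ j, A (τ j) = B j := fun j => congrArg Prod.snd (hτ j)
  refine ⟨τ, hτ1, fun j => ?_⟩
  -- With a target of dimension zero, only the vanishing above the level of `j` is imposed.
  let V : Submodule F C := levelKer (P := P) (len P j) (0 : C →ₗ[F] (Fin 0 → F))
  obtain ⟨T, hT⟩ := exists_linearEquiv_of_ker_eq (V := V) ((a (τ j)).comp V.subtype)
    ((b j).comp V.subtype) (by
      ext v
      have h1 : (v : C) ∈ A (τ j) ↔ (v : C) ∈ B j := by rw [hτ2]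
      have hv : ∀ i, len P j < len P i → ((v : C) : Space F k) i = 0 := v.2.1
      have h2 : (v : C) ∈ A (τ j) ↔ a (τ j) v = 0 :=
        ⟨fun h => h.2, fun h => ⟨by rw [hτ1]; exact hv, h⟩⟩
      have h3 : (v : C) ∈ B j ↔ b j v = 0 := ⟨fun h => h.2, fun h => ⟨hv, h⟩⟩
      exact h2.symm.trans (h1.trans h3))
    (by rw [Module.finrank_fin_fun, Module.finrank_fin_fun, hE.dim_eq (hτ1 j)])
  exact ⟨T, fun c hc => (hT ⟨c, hc, rfl⟩).symm⟩

theorem ConditionE.exists_extension [Fintype F] {P : PartialOrder Ω} (hE : ConditionE F k P)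
    (C : Submodule F (Space F k)) (f : C →ₗ[F] Space F k)
    (hf : ∀ α : C, wt P (f α) = wt P (α : Space F k))
    (hlev : ∀ r, (∀ i, len P i = r → k i = 1) ∨ Module.finrank F C ≤ 1 ∨
      {i | len P i = r}.ncard ≤ Fintype.card F) :
    ∃ φ : Space F k ≃ₗ[F] Space F k, (∀ α, wt P (φ α) = wt P α) ∧ ∀ α : C, φ α = f α := by
  obtain ⟨τ, hτ, hT⟩ := hE.exists_matching C f hf hlev
  choose T hT using hT
  exact hE.1.exists_extension C f τ hτ T hT

theorem ConditionE.mep [Fintype F] {P : PartialOrder Ω} (hE : ConditionE F k P)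
    (hL : LevelCondition F k P) : MEP F k P := by
  intro C f hf
  refine hE.exists_extension C f hf fun r => ?_
  by_cases hr : ∃ u, len P u = r
  · obtain ⟨u, rfl⟩ := hr
    rcases hL _ (one_le_len P u) (len_le_maxChain P u) with h | h
    · exact Or.inl h
    · exact Or.inr (Or.inr h)
  · exact Or.inl fun i hi => absurd ⟨i, hi⟩ hr

theorem transitiveOnEqualWeight_of_extension {P : PartialOrder Ω}
    (h : ∀ (γ : Space F k) (f : (F ∙ γ) →ₗ[F] Space F k),
      (∀ α : (F ∙ γ), wt P (f α) = wt P (α : Space F k)) →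
      ∃ φ : Space F k ≃ₗ[F] Space F k,
        (∀ α, wt P (φ α) = wt P α) ∧ ∀ α : (F ∙ γ), φ α = f α) :
    TransitiveOnEqualWeight F k P := by
  intro γ θ hγθ
  by_cases hγ : γ = 0
  · have hθ : θ = 0 := by rw [← wt_eq_zero (P := P), ← hγθ, hγ, wt_zero]
    exact ⟨LinearEquiv.refl F _, fun _ => rfl, by rw [hγ, hθ]; rfl⟩
  let e := LinearEquiv.toSpanNonzeroSingleton F (Space F k) γ hγ
  have he : ∀ t, ((e t : (F ∙ γ)) : Space F k) = t • γ := fun t => rfl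
  obtain ⟨φ, hφ, hext⟩ := h γ ((LinearMap.toSpanSingleton F _ θ).comp e.symm.toLinearMap) (by
    intro α
    obtain ⟨t, rfl⟩ := e.surjective α
    rw [he]
    simp only [LinearMap.comp_apply, LinearEquiv.coe_coe, LinearEquiv.symm_apply_apply,
      LinearMap.toSpanSingleton_apply]
    by_cases ht : t = 0
    · simp [ht]
    · rw [wt_smul P ht, wt_smul P ht, hγθ])
  refine ⟨φ, hφ, ?_⟩
  have h1 := hext (e 1)
  simpa [he] using h1

theorem ConditionE.transitiveOnEqualWeight [Fintype F] {P : PartialOrder Ω}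
    (hE : ConditionE F k P) : TransitiveOnEqualWeight F k P :=
  transitiveOnEqualWeight_of_extension fun γ f hf =>
    hE.exists_extension _ f hf fun _ => Or.inr (Or.inl ((finrank_span_le_card {γ}).trans (by simp)))

/-! ### Duality for hierarchical posets -/

/-- The dual weight fixes the lowest occupied level of `α` and the number of nonzero blocks there.
Matching the blocks of `α` and `γ` on that level gives a block map `ψ₀` whose error in the pairing
comes only from higher levels. The error is absorbed in block `i₀`, where it is invisible to the
weight. -/
theorem ConditionE.exists_adjoint [Fintype F] {P : PartialOrder Ω} (hE : ConditionE F k P)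
    {α γ : Space F k} (h : wt (dualPoset P) α = wt (dualPoset P) γ) :
    ∃ ψ : Space F k ≃ₗ[F] Space F k, (∀ β, wt P (ψ β) = wt P β) ∧
      ∀ β, innerProd α (ψ β) = innerProd γ β := by
  classical
  by_cases hα : α = 0
  · have hγ : γ = 0 := by rw [← wt_eq_zero (P := dualPoset P), ← h, hα, wt_zero]
    exact ⟨LinearEquiv.refl F _, fun _ => rfl, fun _ => by rw [hα, hγ]; rfl⟩
  let ℓ : Ω → ℕᵒᵈ := fun i => OrderDual.toDual (len P i)
  have hdual : ∀ u v, (dualPoset P).le u v ↔ u = v ∨ ℓ u < ℓ v := fun u v => by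
    change P.le v u ↔ u = v ∨ len P v < len P u
    rw [hE.1.le_iff, eq_comm]
  obtain ⟨i₀, hi₀, hbot⟩ := exists_top ℓ hα
  obtain ⟨hbot', hne, hz⟩ := ncard_level_congr hdual hbot h
  have hbotα : ∀ j, len P j < len P i₀ → α j = 0 := hbot
  have hbotγ : ∀ j, len P j < len P i₀ → γ j = 0 := hbot'
  -- The second component is vacuously true off the level of `i₀`, so the zero patterns are matched
  -- only on that level.
  obtain ⟨τ, hτ⟩ := exists_perm_of_fiber_card_eq
    (fun j => (len P j, len P j = len P i₀ → γ j = 0))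
    (fun j => (len P j, len P j = len P i₀ → α j = 0)) fun ⟨s, p⟩ => by
      simp only [Prod.ext_iff]
      by_cases hs : s = len P i₀
      · subst hs
        rcases Classical.propComplete p with rfl | rfl
        · have key : ∀ x : Space F k, {j | len P j = len P i₀ ∧
              (len P j = len P i₀ → x j = 0) = True} = {j | ℓ j = ℓ i₀ ∧ x j = 0} := by
            intro x
            ext j
            by_cases hj : len P j = len P i₀ <;> simp [hj, ℓ]
          exact (congrArg Set.ncard (key γ)).trans (hz.symm.trans (congrArg Set.ncard (key α)).symm)
        · have key : ∀ x : Space F k, {j | len P j = len P i₀ ∧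
              (len P j = len P i₀ → x j = 0) = False} = {j | ℓ j = ℓ i₀ ∧ x j ≠ 0} := by
            intro x
            ext j
            by_cases hj : len P j = len P i₀ <;> simp [hj, ℓ]
          exact (congrArg Set.ncard (key γ)).trans
            (hne.symm.trans (congrArg Set.ncard (key α)).symm)
      · congr 1
        ext j
        refine and_congr_right fun hj => ?_
        have hj' : len P j ≠ len P i₀ := fun h => hs (hj.symm.trans h)
        simp [hj']
  have hτ1 : ∀ j, len P (τ j) = len P j := fun j => congrArg Prod.fst (hτ j)
  have hτ2 : ∀ j, len P j = len P i₀ → (α j = 0 ↔ γ (τ j) = 0) := by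
    intro j hj
    have h1 : (len P (τ j) = len P i₀ → γ (τ j) = 0) = (len P j = len P i₀ → α j = 0) :=
      congrArg Prod.snd (hτ j)
    rw [hτ1] at h1
    simpa [hj] using h1.symm
  have hT : ∀ j, ∃ T : (Fin (k (τ j)) → F) ≃ₗ[F] (Fin (k j) → F),
      len P j = len P i₀ → ∀ x, α j ⬝ᵥ T x = γ (τ j) ⬝ᵥ x := by
    intro j
    have hk : k j = k (τ j) := (hE.dim_eq (hτ1 j)).symm
    by_cases hj : len P j = len P i₀
    · obtain ⟨T, hT⟩ := exists_linearEquiv_dotProduct hk (α j) (γ (τ j)) (hτ2 j hj)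
      exact ⟨T, fun _ => hT⟩
    · obtain ⟨T, -⟩ := exists_linearEquiv_dotProduct hk (0 : Fin (k j) → F) 0 (by simp)
      exact ⟨T, fun h => absurd h hj⟩
  choose T hT using hT
  obtain ⟨t, ht⟩ := Function.ne_iff.1 hi₀
  let w : Space F k := Pi.single i₀ (Pi.single t (α i₀ t)⁻¹)
  have hw : innerProd α w = 1 := by
    rw [innerProd, Finset.sum_eq_single i₀, Finset.sum_eq_single t]
    · simp only [w, Pi.single_eq_same]
      exact mul_inv_cancel₀ ht
    · intro s _ hs; simp [w, hs]
    · simp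
    · intro j _ hj; simp [w, Pi.single_eq_of_ne hj]
    · simp
  let ψ₀ : Space F k →ₗ[F] Space F k :=
    LinearMap.pi fun j => (T j).toLinearMap.comp (LinearMap.proj (τ j))
  let c : Space F k →ₗ[F] F := innerLin γ - (innerLin α).comp ψ₀
  have hc : ∀ β, c β = innerProd γ β - innerProd α (ψ₀ β) := fun β => rfl
  let ψ : Space F k →ₗ[F] Space F k := ψ₀ + c.smulRight w
  have hψ : ∀ β, ψ β = ψ₀ β + c β • w := fun β => rfl
  have hc0 : ∀ β : Space F k, (∀ i, len P i₀ < len P i → β i = 0) → c β = 0 := by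
    intro β hβ
    have h1 : ∀ j, α j ⬝ᵥ ψ₀ β j = γ (τ j) ⬝ᵥ β (τ j) := by
      intro j
      have h2 : ψ₀ β j = T j (β (τ j)) := rfl
      rcases lt_trichotomy (len P j) (len P i₀) with hj | hj | hj
      · rw [hbotα j hj, hbotγ (τ j) (by rwa [hτ1]), zero_dotProduct, zero_dotProduct]
      · rw [h2, hT j hj]
      · rw [h2, hβ (τ j) (by rwa [hτ1]), map_zero, dotProduct_zero, dotProduct_zero]
    have h3 : innerProd α (ψ₀ β) = innerProd γ β := by
      refine (Finset.sum_congr rfl fun j _ => h1 j).trans ?_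
      exact Equiv.sum_comp τ fun j => γ j ⬝ᵥ β j
    rw [hc, h3, sub_self]
  have hwt : ∀ β, wt P (ψ β) = wt P β := by
    intro β
    refine wt_eq_of_perm (fun u v => hE.1.le_iff) τ hτ1 fun r hr j hj => ?_
    have h1 : (c β • w) j = 0 := by
      by_cases hji : j = i₀
      · subst hji
        rw [hc0 β fun i hi => hr i (hj.trans_lt hi), zero_smul]; rfl
      · simp [w, Pi.single_eq_of_ne hji]
    rw [hψ, Pi.add_apply, h1, add_zero]
    exact (T j).map_eq_zero_iff
  obtain ⟨φ, hφ⟩ := exists_equiv_of_wt_preserving ψ hwt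
  refine ⟨φ, fun β => by rw [hφ, hwt], fun β => ?_⟩
  rw [hφ, hψ, innerProd_add, innerProd_smul, hw, hc]
  ring

theorem ConditionE.le_dualPartition [Fintype F] [DecidableEq Ω] {P : PartialOrder Ω}
    (hE : ConditionE F k P) (χ : AddChar F ℂ) :
    weightPartition F k (dualPoset P) ≤ dualPartition χ (weightPartition F k P) := by
  intro α γ h
  obtain ⟨ψ, hψ, hadj⟩ := hE.exists_adjoint h
  rw [dualPartition_iff]
  intro g hg
  rw [charSum, charSum]
  refine (Fintype.sum_equiv ψ.toEquiv _ _ fun β => ?_).symm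
  have h1 : ψ.toEquiv β = ψ β := rfl
  rw [h1, hadj, hg (ψ β) β (hψ β)]

end PosetWeight

namespace PosetWeight

variable {Ω : Type*} [Fintype Ω]
variable {F : Type*} [Field F] {k : Ω → ℕ}

/-! ### Failure of the extension property on large levels -/

theorem MEP.transitiveOnEqualWeight {P : PartialOrder Ω} (h : MEP F k P) :
    TransitiveOnEqualWeight F k P :=
  transitiveOnEqualWeight_of_extension fun _ f hf => h _ f hf

/-- The linear map whose `i`-th block is `(p i v, p' i v, 0, …, 0)`. -/
def blockMap {V : Type*} [AddCommGroup V] [Module F V] (k : Ω → ℕ) (p p' : Ω → (V →ₗ[F] F)) :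
    V →ₗ[F] Space F k :=
  LinearMap.pi fun i => LinearMap.pi fun t =>
    if t.val = 0 then p i else if t.val = 1 then p' i else 0

theorem blockMap_eq_zero_iff {V : Type*} [AddCommGroup V] [Module F V] {p p' : Ω → (V →ₗ[F] F)}
    {i : Ω} (hi : 2 ≤ k i) (v : V) : blockMap k p p' v i = 0 ↔ p i v = 0 ∧ p' i v = 0 := by
  constructor
  · intro h
    have h0 := congrFun h ⟨0, by omega⟩
    have h1 := congrFun h ⟨1, by omega⟩
    simp only [blockMap, LinearMap.pi_apply, if_true, Pi.zero_apply, one_ne_zero, if_false] at h0 h1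
    exact ⟨h0, h1⟩
  · rintro ⟨h0, h1⟩
    funext t
    simp only [blockMap, LinearMap.pi_apply, Pi.zero_apply]
    split_ifs <;> simp [h0, h1]

theorem blockMap_eq_zero {V : Type*} [AddCommGroup V] [Module F V] {p p' : Ω → (V →ₗ[F] F)}
    {i : Ω} (h0 : p i = 0) (h1 : p' i = 0) (v : V) : blockMap k p p' v i = 0 := by
  funext t
  simp only [blockMap, LinearMap.pi_apply, Pi.zero_apply, h0, h1]
  split_ifs <;> simp

/-- The linear functionals on the plane whose kernels are the lines through the origin. -/
def lineFunctional : Option F → (F × F →ₗ[F] F)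
  | none => LinearMap.snd F F F
  | some a => LinearMap.fst F F F - a • LinearMap.snd F F F

theorem exists_lineFunctional_eq_zero_iff {v : F × F} (hv : v ≠ 0) :
    ∃ z₀ : Option F, ∀ z, lineFunctional z v = 0 ↔ z = z₀ := by
  by_cases h2 : v.2 = 0
  · have h1 : v.1 ≠ 0 := fun h1 => hv (Prod.ext h1 h2)
    refine ⟨none, ?_⟩
    rintro (_ | a)
    · simp [lineFunctional, h2]
    · simp [lineFunctional, h2, h1]
  · refine ⟨some (v.1 / v.2), ?_⟩
    rintro (_ | a)
    · simp [lineFunctional, h2]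
    · simp only [lineFunctional, LinearMap.sub_apply, LinearMap.fst_apply, LinearMap.smul_apply,
        LinearMap.snd_apply, smul_eq_mul, Option.some.injEq]
      rw [sub_eq_zero, eq_div_iff h2, eq_comm]

theorem exists_lineFunctional_ne_zero (z : Option F) : ∃ v : F × F, lineFunctional z v ≠ 0 := by
  rcases z with _ | a
  · exact ⟨(0, 1), by simp [lineFunctional]⟩
  · exact ⟨(1, 0), by simp [lineFunctional]⟩

/-- On a large level with blocks of length at least two, the same plane embeds in two ways that
agree in weight, but only one of which meets every block of the level. -/
theorem exists_pair_of_large_level [Fintype F] {P : PartialOrder Ω} (hP : IsHierarchical P)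
    {r : ℕ} (hk : ∀ i, len P i = r → 2 ≤ k i)
    (hr : Fintype.card F < {i | len P i = r}.ncard) :
    ∃ (x y : F × F →ₗ[F] Space F k) (i₀ : Ω), len P i₀ = r ∧
      (∀ v, wt P (x v) = wt P (y v)) ∧
      (∀ v i, len P i ≠ r → x v i = 0 ∧ y v i = 0) ∧
      (∀ v, y v i₀ = 0) ∧ (∀ v, v ≠ 0 → ∀ i, len P i = r → i ≠ i₀ → y v i ≠ 0) ∧
      (∀ v, v ≠ 0 → ∃ i, len P i = r ∧ x v i = 0) ∧
      ∀ i, len P i = r → ∃ v, x v i ≠ 0 := by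
  classical
  obtain ⟨e⟩ : Nonempty (Option F ↪ {i | len P i = r}) := by
    refine Function.Embedding.nonempty_of_card_le ?_
    rw [Fintype.card_option, ← Nat.card_eq_fintype_card (α := ↥{i | len P i = r}),
      Nat.card_coe_set_eq]
    omega
  let e' : Option F → Ω := fun z => e z
  have he' : Function.Injective e' := fun a b hab => e.injective (Subtype.ext hab)
  have hlen : ∀ z, len P (e' z) = r := fun z => (e z).2
  -- On `q + 1` blocks of the level, `x` uses functionals whose kernels are the lines of the plane;
  -- on its other blocks it is injective. So each nonzero vector has exactly one zero block there.
  let p : Ω → (F × F →ₗ[F] F) := fun i =>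
    if len P i = r then Function.extend e' lineFunctional (fun _ => LinearMap.fst F F F) i else 0
  let p' : Ω → (F × F →ₗ[F] F) := fun i =>
    if len P i = r then Function.extend e' 0 (fun _ => LinearMap.snd F F F) i else 0
  -- `y` has the same number of zero blocks on each nonzero vector, but always in the same place.
  let s : Ω → (F × F →ₗ[F] F) := fun i =>
    if len P i = r ∧ i ≠ e' none then LinearMap.fst F F F else 0
  let s' : Ω → (F × F →ₗ[F] F) := fun i =>
    if len P i = r ∧ i ≠ e' none then LinearMap.snd F F F else 0
  let x := blockMap k p p'
  let y := blockMap k s s'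
  have hx0 : ∀ v i, len P i ≠ r → x v i = 0 := fun v i hi =>
    blockMap_eq_zero (by simp [p, hi]) (by simp [p', hi]) v
  have hy0 : ∀ v i, len P i ≠ r → y v i = 0 := fun v i hi =>
    blockMap_eq_zero (by simp [s, hi]) (by simp [s', hi]) v
  have hxe : ∀ v z, x v (e' z) = 0 ↔ lineFunctional z v = 0 := by
    intro v z
    rw [blockMap_eq_zero_iff (hk _ (hlen z))]
    simp only [p, p', hlen, if_true, he'.extend_apply]
    simp
  have hxn : ∀ v i, len P i = r → (¬ ∃ z, e' z = i) → (x v i = 0 ↔ v = 0) := by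
    intro v i hi hz
    rw [blockMap_eq_zero_iff (hk i hi)]
    simp only [p, p', hi, if_true, Function.extend_apply' _ _ _ hz]
    exact (Prod.ext_iff (x := v) (y := 0)).symm
  have hye : ∀ v, y v (e' none) = 0 := fun v =>
    blockMap_eq_zero (by simp [s]) (by simp [s']) v
  have hyn : ∀ v i, len P i = r → i ≠ e' none → (y v i = 0 ↔ v = 0) := by
    intro v i hi hne
    rw [blockMap_eq_zero_iff (hk i hi)]
    simp only [s, s', hi, hne, ne_eq, not_false_eq_true, and_self, if_true]
    exact (Prod.ext_iff (x := v) (y := 0)).symm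
  have hxz : ∀ v, v ≠ 0 → ∃ z₀, ∀ i, len P i = r → (x v i = 0 ↔ i = e' z₀) := by
    intro v hv
    obtain ⟨z₀, hz₀⟩ := exists_lineFunctional_eq_zero_iff hv
    refine ⟨z₀, fun i hi => ?_⟩
    by_cases hz : ∃ z, e' z = i
    · obtain ⟨z, rfl⟩ := hz
      rw [hxe, hz₀, he'.eq_iff]
    · rw [hxn v i hi hz]
      exact ⟨fun h => absurd h hv, fun h => absurd ⟨z₀, h.symm⟩ hz⟩
  refine ⟨x, y, e' none, hlen none, fun v => ?_, fun v i hi => ⟨hx0 v i hi, hy0 v i hi⟩, hye,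
    fun v hv i hi hne => mt (hyn v i hi hne).1 hv, fun v hv => ?_, fun i hi => ?_⟩
  · by_cases hv : v = 0
    · rw [hv, map_zero, map_zero]
    obtain ⟨z₀, hz₀⟩ := hxz v hv
    have key : ∀ (w : Space F k) (z : Option F), (∀ i, len P i ≠ r → w i = 0) →
        (∀ i, len P i = r → (w i = 0 ↔ i = e' z)) →
        wt P w = {j | len P j < r}.ncard + ({i | len P i = r}.ncard - 1) := by
      intro w z hw0 hw
      have h1 := ncard_top_level (fun u v => hP.le_iff) (r := r) (x := w)
        fun i hi => hw0 i hi.ne'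
      have h2 : {j | len P j = r ∧ w j ≠ 0} = {i | len P i = r} \ {e' z} := by
        ext j
        exact and_congr_right fun hj => not_congr (hw j hj)
      rw [h2, Set.ncard_sdiff_singleton_of_mem (by exact hlen z)] at h1
      have h3 := Fintype.one_lt_card (α := F)
      omega
    rw [key (x v) z₀ (hx0 v) hz₀, key (y v) none (hy0 v) fun i hi => ?_]
    by_cases hne : i = e' none
    · rw [hne]; simp [hye]
    · rw [hyn v i hi hne]; simp [hv, hne]
  · obtain ⟨z₀, hz₀⟩ := hxz v hv
    exact ⟨e' z₀, hlen z₀, (hz₀ _ (hlen z₀)).2 rfl⟩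
  · by_cases hz : ∃ z, e' z = i
    · obtain ⟨z, rfl⟩ := hz
      obtain ⟨v, hv⟩ := exists_lineFunctional_ne_zero z
      exact ⟨v, mt (hxe v z).1 hv⟩
    · exact ⟨(1, 0), mt (hxn _ i hi hz).1 (by simp)⟩

/-- Suppose `φ` extends the map from the image of `x` to that of `y`. Adding a vector `a` supported
on the block always missed by `y` fills the whole level. The preimage `b` of `a` has a single
nonzero block `j` there. For `v` with `x v` nonzero at `j`, the zero block of `x v` differs from
`j`, so `x v + b` still has a zero block and weights disagree. -/
theorem MEP.levelCondition [Fintype F] (hk : ∀ i, 0 < k i) {P : PartialOrder Ω}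
    (h : MEP F k P) (hE : ConditionE F k P) : LevelCondition F k P := by
  classical
  intro r _ _
  by_contra! hcon
  obtain ⟨⟨u, hu, hku⟩, hr⟩ := hcon
  have hP : ∀ u v, P.le u v ↔ u = v ∨ len P u < len P v := fun u v => hE.1.le_iff
  have hk2 : ∀ i, len P i = r → 2 ≤ k i := fun i hi => by
    rw [hE.dim_eq (hi.trans hu.symm)]
    have := hk u
    omega
  obtain ⟨x, y, i₀, hi₀, hxy, h0, hy0, hyn, hxz, hxn⟩ := exists_pair_of_large_level hE.1 hk2 hr
  have hinj : Function.Injective x := by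
    refine (injective_iff_map_eq_zero x).2 fun v hv => ?_
    by_contra hv0
    have h1 : y v = 0 := by rw [← wt_eq_zero (P := P), ← hxy, hv, wt_zero]
    have h2 := Fintype.one_lt_card (α := F)
    -- A second block exists since the level has more than `q` blocks; `y` is nonzero there off the
    -- origin, which makes `x` injective.
    obtain ⟨i, hi, hne⟩ := Set.exists_ne_of_one_lt_ncard (h2.trans hr) i₀
    exact hyn v hv0 i hi hne (by rw [h1]; rfl)
  let e := LinearEquiv.ofInjective x hinj
  obtain ⟨φ, hφ, hext⟩ := h (LinearMap.range x) (y.comp e.symm.toLinearMap) (by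
    intro α
    obtain ⟨v, rfl⟩ := e.surjective α
    simp only [LinearMap.comp_apply, LinearEquiv.coe_coe, LinearEquiv.symm_apply_apply]
    exact (hxy v).symm)
  have hφx : ∀ v, φ (x v) = y v := fun v => by
    have := hext (e v)
    simpa [e] using this
  set a : Space F k := indVec F k {i₀}
  have ha : ∀ i, a i ≠ 0 ↔ i = i₀ := fun i => by
    have : i ∈ supp a ↔ i ∈ ({i₀} : Set Ω) := by rw [supp_indVec hk]
    exact this
  have ha0 : ∀ i, i ≠ i₀ → a i = 0 := fun i hi => not_not.1 (mt (ha i).1 hi)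
  set b := φ.symm a
  have hb : φ b = a := φ.apply_symm_apply a
  obtain ⟨hb0, hcard, -⟩ := ncard_level_congr hP (x := a) (y := b) (r := r)
    (fun i hi => ha0 i fun h => by rw [h, hi₀] at hi; exact lt_irrefl _ hi) (by rw [← hb, hφ])
  have hset : {j | len P j = r ∧ a j ≠ 0} = {i₀} := by
    ext j
    simp only [Set.mem_ofPred_eq, ha, Set.mem_singleton_iff]
    exact ⟨fun h => h.2, fun h => ⟨h ▸ hi₀, h⟩⟩
  rw [hset, Set.ncard_singleton] at hcard
  obtain ⟨j, hj⟩ := Set.ncard_eq_one.1 hcard.symm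
  have hjr : len P j = r := (hj.symm ▸ Set.mem_singleton j : j ∈ {j | len P j = r ∧ b j ≠ 0}).1
  obtain ⟨v, hv⟩ := hxn j hjr
  have hv0 : v ≠ 0 := by
    rintro rfl
    exact hv (by rw [map_zero]; rfl)
  obtain ⟨l, hl, hxl⟩ := hxz v hv0
  have hcard2 := (ncard_level_congr hP (x := x v + b) (y := y v + a) (r := r)
    (fun i hi => by rw [Pi.add_apply, (h0 v i hi.ne').1, hb0 i hi, add_zero])
    (by rw [← hφ, map_add, hφx, hb])).2.1
  have hset2 : {j | len P j = r ∧ (y v + a) j ≠ 0} = {i | len P i = r} := by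
    ext i
    simp only [Set.mem_ofPred_eq, and_iff_left_iff_imp, Pi.add_apply]
    intro hi
    by_cases hne : i = i₀
    · rw [hne, hy0, zero_add]
      exact (ha i₀).2 rfl
    · rw [ha0 i hne, add_zero]
      exact hyn v hv0 i hi hne
  rw [hset2] at hcard2
  refine absurd hcard2 (ne_of_lt (Set.ncard_lt_ncard ⟨fun i hi => hi.1, fun hsub => ?_⟩))
  have hlj : l ≠ j := fun h => hv (h ▸ hxl)
  have hbl : b l = 0 := by
    by_contra hc
    have : l ∈ ({j} : Set Ω) := hj ▸ (⟨hl, hc⟩ : l ∈ {j | len P j = r ∧ b j ≠ 0})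
    exact hlj this
  exact (hsub hl).2 (by rw [Pi.add_apply, hxl, hbl, add_zero])

end PosetWeight

/-! ### Assembly of the equivalences. -/

open PosetWeight in
theorem corollary6p2 {Ω : Type*} [Fintype Ω] [Nonempty Ω] (P : PartialOrder Ω)
    {F : Type*} [Field F] [Fintype F] (k : Ω → ℕ) (hk : ∀ i, 0 < k i)
    (χ : AddChar F ℂ) (hχ : χ ≠ 1) :
    (MEP F k P ↔ ConditionE F k P ∧ LevelCondition F k P) ∧
    List.TFAE
      [TransitiveOnEqualWeight F k P,
       ConditionE F k P,
       weightPartition F k (dualPoset P) = dualPartition χ (weightPartition F k P),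
       MacWilliamsIdentity F k P,
       FourierReflexive χ (weightPartition F k P)] := by
  classical
  refine ⟨⟨fun h => ?_, fun h => h.1.mep h.2⟩, ?_⟩
  · have hE := h.transitiveOnEqualWeight.hasIntersectionNumbers.conditionE hk
    exact ⟨hE, h.levelCondition hk hE⟩
  -- One inclusion suffices: equality of dimensions supplies its mirror image, and the two together
  -- give both the equality of partitions and reflexivity.
  have hdual : weightPartition F k (dualPoset P) ≤ dualPartition χ (weightPartition F k P) →
      dualPartition χ (weightPartition F k P) = weightPartition F k (dualPoset P) ∧
        FourierReflexive χ (weightPartition F k P) := by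
    intro h
    have h' := weightPartition_le_dualPartition_symm hχ hk h
    have h1 := dualPartition_eq_of_le hχ h h'
    exact ⟨h1, by rw [FourierReflexive, h1, dualPartition_eq_of_le hχ h' h]⟩
  tfae_have 1 → 2 := fun h => h.hasIntersectionNumbers.conditionE hk
  tfae_have 2 → 1 := fun h => h.transitiveOnEqualWeight
  tfae_have 2 → 3 := fun h => (hdual (h.le_dualPartition χ)).1.symm
  tfae_have 3 → 4 := fun h => macWilliamsIdentity_of_le hχ h.le
  tfae_have 4 → 5 := fun h => (hdual (h.le_dualPartition hχ)).2
  tfae_have 5 → 2 := fun h => (h.hasIntersectionNumbers hχ).conditionE hk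
  tfae_finish
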